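/- Let $\mathcal H$ be a complex Hilbert space and let $S_1$ be the Schatten class of compact operators $A$ on $\mathcal H$ with $\|A\|_{S_1}=\operatorname{tr}|A|<\infty$, where $|A|=\sqrt{A^*A}$. For $f\in L^1(\mathbb T;S_1)$ (Bochner integrable), put $\hat f(n)=\frac1{2\pi}\int_{-\pi}^{\pi}f(t)e^{-int}\,dt$ for $n\in\mathbb Z$ and $\|f\|_{L^1(\mathbb T;S_1)}=\frac1{2\pi}\int_{-\pi}^{\pi}\|f(t)\|_{S_1}\,dt$. For a sequence $(c_j)_{j\ge 0}$ of compact operators on $\mathcal H$ let $$\|(c_j)\|_{\mathcal C_E}=\operatorname{tr}\sqrt{\sum_j c_j^*c_j}\in[0,\infty],\qquad |||(c_j)|||=\inf\bigl\{\|(a_j)\|_{\mathcal C_E}+\|(b_j^*)\|_{\mathcal C_E} : (c_j)=(a_j)+(b_j)\bigr\},$$ where the infimum is over splittings into sequences of compact operators, and $\|(c_j)\|_{\mathcal C_E}=\infty$ if the series $\sum_j c_j^*c_j$ does not converge in operator norm. There is an absolute constant $C>0$ such that the following holds for every $\mathcal H$. Let $(k_j)_{j\ge 0}$ be a sequence of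 nonnegative integers with $k_{j+1}>2k_j$ for all $j$, and let $K=\{k_j : j\ge 0\}$ (such a set is called strongly lacunary). If $f\in L^1(\mathbb T;S_1)$ and $\hat f(n)=0$ for every integer $n\notin K$, then $$|||(\hat f(k_j))|||\le C\,\|f\|_{L^1(\mathbb T;S_1)}.$$ -/

import Mathlib

open scoped InnerProductSpace ENNReal

/-! ### The trace of a positive operator -/

section Trace

theorem tsum_enorm_inner_sq {ι H : Type*} [NormedAddCommGroup H] [InnerProductSpace ℂ H]
    (b : HilbertBasis ι ℂ H) (x : H) :
    ∑' i, ‖⟪b i, x⟫_ℂ‖ₑ ^ 2 = ‖x‖ₑ ^ 2 := by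
  have h := b.hasSum_inner_mul_inner x x
  have h2 : HasSum (fun i => ‖⟪b i, x⟫_ℂ‖ ^ 2) (‖x‖ ^ 2) := by
    have h3 := Complex.hasSum_re h
    convert h3 using 1
    · funext i
      rw [← inner_conj_symm x (b i), mul_comm, Complex.mul_conj, Complex.ofReal_re,
        Complex.normSq_eq_norm_sq]
    · have := inner_self_eq_norm_sq (𝕜 := ℂ) x
      simpa using this.symm
  have h4 := h2.tsum_eq
  have h5 : ENNReal.ofReal (∑' i, ‖⟪b i, x⟫_ℂ‖ ^ 2) = ENNReal.ofReal (‖x‖ ^ 2) := by rw [h4]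
  rw [ENNReal.ofReal_tsum_of_nonneg (fun i => by positivity) h2.summable] at h5
  simpa [ENNReal.ofReal_pow, ofReal_norm] using h5

variable {H : Type*} [NormedAddCommGroup H] [InnerProductSpace ℂ H] [CompleteSpace H]

variable (H) in
/-- A fixed orthonormal basis of the complex Hilbert space `H`
(which one is irrelevant, see `opTrace_eq_tsum`). -/
noncomputable def onb :
    HilbertBasis (exists_hilbertBasis ℂ H).choose ℂ H :=
  (exists_hilbertBasis ℂ H).choose_spec.choose

/-- The trace `∑ i, ⟪e i, T (e i)⟫ ∈ [0, ∞]` of a positive operator `T`,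
for an orthonormal basis `e`. -/
noncomputable def opTrace (T : H →L[ℂ] H) : ℝ≥0∞ :=
  ∑' i, ENNReal.ofReal (⟪onb H i, T (onb H i)⟫_ℂ).re

theorem tsum_enorm_adjoint_sq {ι κ : Type*} (b : HilbertBasis ι ℂ H) (c : HilbertBasis κ ℂ H)
    (A : H →L[ℂ] H) : ∑' i, ‖(star A) (b i)‖ₑ ^ 2 = ∑' j, ‖A (c j)‖ₑ ^ 2 := by
  simp_rw [← tsum_enorm_inner_sq c ((star A) _), ← tsum_enorm_inner_sq b (A _)]
  rw [ENNReal.tsum_comm]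
  refine tsum_congr fun j => tsum_congr fun i => ?_
  rw [ContinuousLinearMap.star_eq_adjoint, ContinuousLinearMap.adjoint_inner_right,
    ← inner_conj_symm, RCLike.enorm_conj]

theorem ofReal_inner_star_mul_self (A : H →L[ℂ] H) (x : H) :
    ENNReal.ofReal (⟪x, (star A * A) x⟫_ℂ).re = ‖A x‖ₑ ^ 2 := by
  rw [mul_apply_eq_comp, ContinuousLinearMap.star_eq_adjoint,
    ContinuousLinearMap.adjoint_inner_right]
  have := inner_self_eq_norm_sq (𝕜 := ℂ) (A x)
  simp only [RCLike.re_to_complex] at this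
  rw [this, ENNReal.ofReal_pow (norm_nonneg _), ofReal_norm]

theorem star_sqrt_mul_sqrt {T : H →L[ℂ] H} (hT : 0 ≤ T) :
    star (CFC.sqrt T) * CFC.sqrt T = T := by
  rw [(CFC.sqrt_nonneg T).isSelfAdjoint.star_eq, CFC.sqrt_mul_sqrt_self T hT]

/-- The trace of a positive operator may be computed in every orthonormal basis. -/
theorem opTrace_eq_tsum {ι : Type*} (b : HilbertBasis ι ℂ H) {T : H →L[ℂ] H} (hT : 0 ≤ T) :
    opTrace T = ∑' i, ENNReal.ofReal (⟪b i, T (b i)⟫_ℂ).re := by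
  rw [opTrace, ← star_sqrt_mul_sqrt hT]
  simp_rw [ofReal_inner_star_mul_self]
  rw [← tsum_enorm_adjoint_sq b b, ← tsum_enorm_adjoint_sq b (onb H)]

end Trace

/-! ### The trace norm -/

section TraceNorm

variable {H : Type*} [NormedAddCommGroup H] [InnerProductSpace ℂ H] [CompleteSpace H]

/-- The trace norm `tr |A| ∈ [0, ∞]` of a bounded operator `A`, with `|A| = √(A* A)`. -/
noncomputable def traceENorm (A : H →L[ℂ] H) : ℝ≥0∞ :=
  opTrace (CFC.abs A)

theorem exists_polar_approx (A : H →L[ℂ] H) {ε : ℝ} (hε : 0 < ε) :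
    ∃ U : H →L[ℂ] H, ‖U‖ ≤ 1 ∧ ‖A - U * CFC.abs A‖ ≤ ε ∧ ‖CFC.abs A - star U * A‖ ≤ ε := by
  set P := CFC.abs A with hP
  have hP0 : 0 ≤ P := CFC.abs_nonneg A
  have hPsa : IsSelfAdjoint P := hP0.isSelfAdjoint
  have hPP : star A * A = P * P := (CFC.abs_mul_abs A).symm
  have hsp : ∀ x ∈ spectrum ℝ P, 0 ≤ x := fun x hx => spectrum_nonneg_of_nonneg hP0 hx
  have hg : ContinuousOn (fun x : ℝ => (x + ε)⁻¹) (spectrum ℝ P) :=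
    ContinuousOn.inv₀ (by fun_prop) fun x hx => by have := hsp x hx; positivity
  set G := cfc (fun x : ℝ => (x + ε)⁻¹) P with hG
  have hGsa : star G = G := (cfc_predicate (fun x : ℝ => (x + ε)⁻¹) P : IsSelfAdjoint _).star_eq
  have hid : cfc (fun x : ℝ => x) P = P := cfc_id' ℝ P
  have hGP : G * P = cfc (fun x : ℝ => (x + ε)⁻¹ * x) P := by
    rw [cfc_mul _ _ P hg (by fun_prop), hid]
  have hPG : P * G = cfc (fun x : ℝ => x * (x + ε)⁻¹) P := by
    rw [cfc_mul _ _ P (by fun_prop) hg, hid]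
  have hcomm : G * P = P * G := by
    rw [hGP, hPG]; congr 1; funext x; ring
  have hGPn : ‖G * P‖ ≤ 1 := by
    rw [hGP]
    refine norm_cfc_le zero_le_one fun x hx => ?_
    have := hsp x hx
    rw [Real.norm_of_nonneg (by positivity), inv_mul_le_iff₀ (by positivity)]
    linarith
  have hD : ‖P - G * P * P‖ ≤ ε := by
    have : P - G * P * P = cfc (fun x : ℝ => x - (x + ε)⁻¹ * x * x) P := by
      have c1 : ContinuousOn (fun x : ℝ => (x + ε)⁻¹ * x) (spectrum ℝ P) := hg.mul continuousOn_id
      have c2 : ContinuousOn (fun x : ℝ => (x + ε)⁻¹ * x * x) (spectrum ℝ P) :=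
        c1.mul continuousOn_id
      rw [cfc_sub (fun x : ℝ => x) (fun x : ℝ => (x + ε)⁻¹ * x * x) P continuousOn_id c2,
        cfc_mul (fun x : ℝ => (x + ε)⁻¹ * x) (fun x : ℝ => x) P c1 continuousOn_id, ← hGP, hid]
    rw [this]
    refine norm_cfc_le hε.le fun x hx => ?_
    have h0 := hsp x hx
    have : x - (x + ε)⁻¹ * x * x = ε * x / (x + ε) := by
      field_simp
      ring
    rw [this, Real.norm_of_nonneg (by positivity), div_le_iff₀ (by positivity)]
    nlinarith
  refine ⟨A * G, ?_, ?_, ?_⟩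
  · have h1 : star (A * G) * (A * G) = star (G * P) * (G * P) := by
      rw [star_mul, star_mul, hGsa, hPsa.star_eq]
      calc G * star A * (A * G) = G * (star A * A) * G := by noncomm_ring
        _ = (G * P) * (P * G) := by rw [hPP]; noncomm_ring
        _ = P * G * (G * P) := by rw [hcomm]
    have h2 : ‖A * G‖ * ‖A * G‖ = ‖G * P‖ * ‖G * P‖ := by
      rw [← CStarRing.norm_star_mul_self, h1, CStarRing.norm_star_mul_self]
    nlinarith [norm_nonneg (A * G), norm_nonneg (G * P)]
  · have h1 : star (A - A * G * P) * (A - A * G * P) =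
        star (P - G * P * P) * (P - G * P * P) := by
      have e1 : A - A * G * P = A * (1 - G * P) := by noncomm_ring
      have e2 : P - G * P * P = P * (1 - G * P) := by
        rw [mul_sub, mul_one, hcomm, mul_assoc, hcomm]
      rw [e1, e2, star_mul, star_mul, hPsa.star_eq]
      calc star (1 - G * P) * star A * (A * (1 - G * P))
          = star (1 - G * P) * (star A * A) * (1 - G * P) := by simp only [mul_assoc]
        _ = star (1 - G * P) * P * (P * (1 - G * P)) := by rw [hPP]; simp only [mul_assoc]
    have h2 : ‖A - A * G * P‖ * ‖A - A * G * P‖ = ‖P - G * P * P‖ * ‖P - G * P * P‖ := by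
      rw [← CStarRing.norm_star_mul_self, h1, CStarRing.norm_star_mul_self]
    nlinarith [norm_nonneg (A - A * G * P), norm_nonneg (P - G * P * P)]
  · have : star (A * G) * A = G * P * P := by
      rw [star_mul, hGsa, mul_assoc, hPP, mul_assoc]
    rw [this]; exact hD

theorem tsum_enorm_star_mul_le (V R : H →L[ℂ] H) (hV : ‖V‖ ≤ 1) :
    ∑' i, ‖(star (V * R)) (onb H i)‖ₑ ^ 2 ≤ ∑' i, ‖R (onb H i)‖ₑ ^ 2 := by
  rw [tsum_enorm_adjoint_sq (onb H) (onb H)]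
  refine ENNReal.tsum_le_tsum fun i => ?_
  gcongr
  rw [enorm_le_iff_norm_le]
  calc ‖V (R (onb H i))‖ ≤ ‖V‖ * ‖R (onb H i)‖ := V.le_opNorm _
    _ ≤ 1 * ‖R (onb H i)‖ := by gcongr
    _ = _ := one_mul _

theorem opTrace_eq_sqrt {T : H →L[ℂ] H} (hT : 0 ≤ T) :
    opTrace T = ∑' i, ‖CFC.sqrt T (onb H i)‖ₑ ^ 2 := by
  conv_lhs => rw [opTrace, ← star_sqrt_mul_sqrt hT]
  simp_rw [ofReal_inner_star_mul_self]

theorem ofReal_sum_mul_pos_le {T : H →L[ℂ] H} (hT : 0 ≤ T) (V : H →L[ℂ] H) (hV : ‖V‖ ≤ 1)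
    (F : Finset (exists_hilbertBasis ℂ H).choose) :
    ENNReal.ofReal (∑ i ∈ F, (⟪onb H i, (V * T) (onb H i)⟫_ℂ).re) ≤ opTrace T := by
  set R := CFC.sqrt T with hR
  have hRsa : star R = R := (CFC.sqrt_nonneg T).isSelfAdjoint.star_eq
  have hRR : R * R = T := CFC.sqrt_mul_sqrt_self T hT
  have key : ∀ i, (⟪onb H i, (V * T) (onb H i)⟫_ℂ).re ≤
      (‖(star (V * R)) (onb H i)‖ ^ 2 + ‖R (onb H i)‖ ^ 2) / 2 := by
    intro i
    have e : ⟪onb H i, (V * T) (onb H i)⟫_ℂ = ⟪(star (V * R)) (onb H i), R (onb H i)⟫_ℂ := by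
      rw [ContinuousLinearMap.star_eq_adjoint, ContinuousLinearMap.adjoint_inner_left, ← hRR,
        ← mul_assoc, mul_apply_eq_comp]
    rw [e]
    have h1 := (Complex.re_le_norm _).trans
      (norm_inner_le_norm (𝕜 := ℂ) ((star (V * R)) (onb H i)) (R (onb H i)))
    nlinarith [sq_nonneg (‖(star (V * R)) (onb H i)‖ - ‖R (onb H i)‖)]
  by_cases htop : opTrace T = ⊤
  · rw [htop]; exact le_top
  have e2 := opTrace_eq_sqrt hT
  rw [← hR] at e2
  have b2 : ∑ i ∈ F, ‖R (onb H i)‖ ^ 2 ≤ (opTrace T).toReal := by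
    rw [← ENNReal.ofReal_le_iff_le_toReal htop, ENNReal.ofReal_sum_of_nonneg (by intros; positivity)]
    simp_rw [ENNReal.ofReal_pow (norm_nonneg _), ofReal_norm]
    rw [e2]; exact ENNReal.sum_le_tsum F
  have b1 : ∑ i ∈ F, ‖(star (V * R)) (onb H i)‖ ^ 2 ≤ (opTrace T).toReal := by
    rw [← ENNReal.ofReal_le_iff_le_toReal htop, ENNReal.ofReal_sum_of_nonneg (by intros; positivity)]
    simp_rw [ENNReal.ofReal_pow (norm_nonneg _), ofReal_norm]
    rw [e2]
    exact (ENNReal.sum_le_tsum F).trans (tsum_enorm_star_mul_le V R hV)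
  rw [ENNReal.ofReal_le_iff_le_toReal htop]
  calc _ ≤ ∑ i ∈ F, (‖(star (V * R)) (onb H i)‖ ^ 2 + ‖R (onb H i)‖ ^ 2) / 2 :=
        Finset.sum_le_sum fun i _ => key i
    _ = (∑ i ∈ F, ‖(star (V * R)) (onb H i)‖ ^ 2 + ∑ i ∈ F, ‖R (onb H i)‖ ^ 2) / 2 := by
        rw [← Finset.sum_div, Finset.sum_add_distrib]
    _ ≤ _ := by linarith

theorem sum_inner_le_add (S T : H →L[ℂ] H) (F : Finset (exists_hilbertBasis ℂ H).choose) :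
    ∑ i ∈ F, (⟪onb H i, S (onb H i)⟫_ℂ).re ≤
      ∑ i ∈ F, (⟪onb H i, T (onb H i)⟫_ℂ).re + F.card * ‖S - T‖ := by
  rw [← nsmul_eq_mul, ← Finset.sum_const, ← Finset.sum_add_distrib]
  refine Finset.sum_le_sum fun i _ => ?_
  have h1 : (⟪onb H i, (S - T) (onb H i)⟫_ℂ).re ≤ ‖S - T‖ := by
    refine (Complex.re_le_norm _).trans ((norm_inner_le_norm _ _).trans ?_)
    have h2 : ‖onb H i‖ = 1 := (onb H).orthonormal.1 i
    have h3 := (S - T).le_opNorm (onb H i)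
    rw [h2] at h3 ⊢
    linarith
  rw [sub_apply, inner_sub_right, Complex.sub_re] at h1
  linarith

/-- Dual description of the trace norm. -/
theorem traceENorm_le_iff (A : H →L[ℂ] H) (M : ℝ≥0∞) :
    traceENorm A ≤ M ↔ ∀ V : H →L[ℂ] H, ‖V‖ ≤ 1 →
      ∀ F : Finset (exists_hilbertBasis ℂ H).choose,
        ENNReal.ofReal (∑ i ∈ F, (⟪onb H i, (V * A) (onb H i)⟫_ℂ).re) ≤ M := by
  have hpos := CFC.abs_nonneg A
  have lim : ∀ (a n : ℝ) (M : ℝ≥0∞), 0 ≤ n → M ≠ ⊤ →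
      (∀ ε : ℝ, 0 < ε → a ≤ M.toReal + n * ε) → ENNReal.ofReal a ≤ M := by
    intro a n M hn hM h
    rw [ENNReal.ofReal_le_iff_le_toReal hM]
    refine le_of_forall_pos_le_add fun δ hδ => (h (δ / (n + 1)) (by positivity)).trans ?_
    gcongr
    rw [mul_div_assoc', div_le_iff₀ (by positivity)]
    nlinarith
  constructor
  · intro h V hV F
    refine le_trans ?_ h
    by_cases htop : traceENorm A = ⊤
    · rw [htop]; exact le_top
    refine lim _ F.card _ (by positivity) htop fun ε hε => ?_
    obtain ⟨U, hU, h1, -⟩ := exists_polar_approx A hε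
    have h2 := ofReal_sum_mul_pos_le hpos (V * U)
      ((norm_mul_le V U).trans (mul_le_one₀ hV (norm_nonneg _) hU)) F
    rw [← traceENorm, ENNReal.ofReal_le_iff_le_toReal htop] at h2
    refine (sum_inner_le_add (V * A) (V * U * CFC.abs A) F).trans ?_
    gcongr
    calc ‖V * A - V * U * CFC.abs A‖ = ‖V * (A - U * CFC.abs A)‖ := by
          rw [mul_sub, mul_assoc]
      _ ≤ ‖V‖ * ‖A - U * CFC.abs A‖ := norm_mul_le _ _
      _ ≤ 1 * ε := by gcongr
      _ = ε := one_mul _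
  · intro h
    by_cases hM : M = ⊤
    · rw [hM]; exact le_top
    rw [traceENorm, opTrace, ENNReal.tsum_eq_iSup_sum]
    refine iSup_le fun F => ?_
    have hnn : ∀ i ∈ F, 0 ≤ (⟪onb H i, CFC.abs A (onb H i)⟫_ℂ).re := fun i _ =>
      ((ContinuousLinearMap.nonneg_iff_isPositive _).1 hpos).re_inner_nonneg_right (onb H i)
    rw [← ENNReal.ofReal_sum_of_nonneg hnn]
    refine lim _ F.card _ (by positivity) hM fun ε hε => ?_
    obtain ⟨U, hU, -, h1⟩ := exists_polar_approx A hε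
    have h2 := h (star U) (by rwa [norm_star]) F
    rw [ENNReal.ofReal_le_iff_le_toReal hM] at h2
    refine (sum_inner_le_add (CFC.abs A) (star U * A) F).trans ?_
    gcongr

theorem traceENorm_add_le (A B : H →L[ℂ] H) :
    traceENorm (A + B) ≤ traceENorm A + traceENorm B := by
  rw [traceENorm_le_iff]
  intro V hV F
  have hA := (traceENorm_le_iff A _).1 le_rfl V hV F
  have hB := (traceENorm_le_iff B _).1 le_rfl V hV F
  refine le_trans ?_ (add_le_add hA hB)
  rw [mul_add]
  simp only [add_apply, inner_add_right, Complex.add_re,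
    Finset.sum_add_distrib]
  exact ENNReal.ofReal_add_le

theorem traceENorm_smul (c : ℂ) (A : H →L[ℂ] H) :
    traceENorm (c • A) = ‖c‖ₑ * traceENorm A := by
  rw [traceENorm, traceENorm, CFC.abs_smul, opTrace, opTrace, ← ENNReal.tsum_mul_left]
  refine tsum_congr fun i => ?_
  rw [smul_apply, inner_smul_right_eq_smul, Complex.smul_re, smul_eq_mul,
    ENNReal.ofReal_mul (norm_nonneg _), ofReal_norm]

theorem traceENorm_zero : traceENorm (0 : H →L[ℂ] H) = 0 := by
  simp [traceENorm, opTrace]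

theorem enorm_le_traceENorm (A : H →L[ℂ] H) : ‖A‖ₑ ≤ traceENorm A := by
  by_cases htop : traceENorm A = ⊤
  · rw [htop]; exact le_top
  have hpos := CFC.abs_nonneg A
  set R := CFC.sqrt (CFC.abs A) with hR
  have hRsa : star R = R := (CFC.sqrt_nonneg _).isSelfAdjoint.star_eq
  have h1 : ‖A‖ = ‖R‖ * ‖R‖ := by
    rw [← CStarRing.norm_star_mul_self, hR, star_sqrt_mul_sqrt hpos, CFC.norm_abs]
  have h2 : traceENorm A = ∑' i, ‖R (onb H i)‖ₑ ^ 2 := opTrace_eq_sqrt hpos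
  have h3 : ∀ y : H, ‖R y‖ₑ ^ 2 ≤ traceENorm A * ‖y‖ₑ ^ 2 := by
    intro y
    rw [← tsum_enorm_inner_sq (onb H), h2, ← ENNReal.tsum_mul_right]
    refine ENNReal.tsum_le_tsum fun i => ?_
    rw [← mul_pow]
    gcongr
    have e : ⟪onb H i, R y⟫_ℂ = ⟪R (onb H i), y⟫_ℂ := by
      conv_rhs => rw [← hRsa, ContinuousLinearMap.star_eq_adjoint,
        ContinuousLinearMap.adjoint_inner_left]
    rw [e, ← ofReal_norm, ← ofReal_norm, ← ofReal_norm,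
      ← ENNReal.ofReal_mul (norm_nonneg _)]
    exact ENNReal.ofReal_le_ofReal (norm_inner_le_norm _ _)
  have h4 : ‖R‖ ≤ √(traceENorm A).toReal := by
    refine R.opNorm_le_bound (Real.sqrt_nonneg _) fun y => ?_
    refine abs_le_of_sq_le_sq' ?_ (by positivity) |>.2
    rw [mul_pow, Real.sq_sqrt ENNReal.toReal_nonneg]
    have := ENNReal.toReal_mono (ENNReal.mul_ne_top htop (by finiteness)) (h3 y)
    simpa [ENNReal.toReal_mul] using this
  rw [← ofReal_norm, ENNReal.ofReal_le_iff_le_toReal htop, h1]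
  calc ‖R‖ * ‖R‖ ≤ √(traceENorm A).toReal * √(traceENorm A).toReal := by gcongr
    _ = _ := Real.mul_self_sqrt ENNReal.toReal_nonneg

theorem isClosed_traceENorm_le (M : ℝ≥0∞) : IsClosed {A : H →L[ℂ] H | traceENorm A ≤ M} := by
  simp_rw [traceENorm_le_iff, Set.ofPred_forall]
  refine isClosed_iInter fun V => isClosed_iInter fun _ => isClosed_iInter fun F => ?_
  refine isClosed_le (ENNReal.continuous_ofReal.comp ?_) continuous_const
  refine continuous_finsetSum F fun i _ => Complex.continuous_re.comp ?_
  have : Continuous fun A : H →L[ℂ] H => (V * A) (onb H i) := by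
    simp only [mul_apply_eq_comp]; fun_prop
  exact continuous_const.inner this

end TraceNorm

/-! ### The Schatten class `S₁` as a Banach space -/

section SchattenOne

variable (H : Type*) [NormedAddCommGroup H] [InnerProductSpace ℂ H] [CompleteSpace H]

/-- The subspace of all compact operators `A` on `H` with `tr |A| < ∞`. -/
noncomputable def schattenOneSubmodule : Submodule ℂ (H →L[ℂ] H) where
  carrier := {A | IsCompactOperator A ∧ traceENorm A < ⊤}
  zero_mem' := ⟨isCompactOperator_zero, by rw [traceENorm_zero]; exact ENNReal.zero_lt_top⟩
  add_mem' := fun {A B} hA hB => ⟨hA.1.add hB.1,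
    (traceENorm_add_le A B).trans_lt (ENNReal.add_lt_top.2 ⟨hA.2, hB.2⟩)⟩
  smul_mem' := fun c A hA => ⟨hA.1.smul c, by
    rw [traceENorm_smul]; exact ENNReal.mul_lt_top (by finiteness) hA.2⟩

/-- The Schatten class `S₁` on `H`, with the norm `‖A‖ = tr |A|`
(and not with the operator norm). -/
def SchattenOne : Type _ := ↥(schattenOneSubmodule H)

namespace SchattenOne

noncomputable instance : AddCommGroup (SchattenOne H) :=
  inferInstanceAs (AddCommGroup (schattenOneSubmodule H))

noncomputable instance : Module ℂ (SchattenOne H) :=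
  inferInstanceAs (Module ℂ (schattenOneSubmodule H))

/-- The inclusion of `S₁` into the bounded operators. -/
noncomputable def toCLM : SchattenOne H →ₗ[ℂ] (H →L[ℂ] H) :=
  (schattenOneSubmodule H).subtype

noncomputable instance : Norm (SchattenOne H) := ⟨fun A => (traceENorm (toCLM H A)).toReal⟩

variable {H}

theorem norm_def (A : SchattenOne H) : ‖A‖ = (traceENorm (toCLM H A)).toReal := rfl

theorem toCLM_injective : Function.Injective (toCLM H) := Subtype.val_injective

theorem isCompactOperator (A : SchattenOne H) : IsCompactOperator (toCLM H A) := A.2.1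

theorem traceENorm_ne_top (A : SchattenOne H) : traceENorm (toCLM H A) ≠ ⊤ := A.2.2.ne

theorem norm_toCLM_le (A : SchattenOne H) : ‖toCLM H A‖ ≤ ‖A‖ := by
  rw [norm_def, ← ENNReal.ofReal_le_iff_le_toReal A.traceENorm_ne_top, ofReal_norm]
  exact enorm_le_traceENorm _

theorem normedSpaceCore : NormedSpace.Core ℂ (SchattenOne H) where
  norm_nonneg _ := ENNReal.toReal_nonneg
  norm_smul c A := by
    rw [norm_def, norm_def, map_smul, traceENorm_smul, ENNReal.toReal_mul, toReal_enorm]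
  norm_triangle A B := by
    rw [norm_def, norm_def, norm_def, map_add,
      ← ENNReal.toReal_add A.traceENorm_ne_top B.traceENorm_ne_top]
    exact ENNReal.toReal_mono (ENNReal.add_ne_top.2 ⟨A.traceENorm_ne_top, B.traceENorm_ne_top⟩)
      (traceENorm_add_le _ _)
  norm_eq_zero_iff A := by
    constructor
    · intro h
      have := norm_toCLM_le A
      rw [h] at this
      exact toCLM_injective (by rw [map_zero]; exact norm_le_zero_iff.1 this)
    · rintro rfl
      rw [norm_def, map_zero, traceENorm_zero, ENNReal.toReal_zero]

noncomputable instance : NormedAddCommGroup (SchattenOne H) :=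
  NormedAddCommGroup.ofCore normedSpaceCore

noncomputable instance : NormedSpace ℂ (SchattenOne H) :=
  NormedSpace.ofCore normedSpaceCore

/-- `S₁` is complete, so that Bochner integrals of `S₁`-valued functions are meaningful. -/
instance : CompleteSpace (SchattenOne H) := by
  refine Metric.complete_of_cauchySeq_tendsto fun u hu => ?_
  have hu' : CauchySeq fun n => toCLM H (u n) := by
    rw [Metric.cauchySeq_iff] at hu ⊢
    intro ε hε
    obtain ⟨N, hN⟩ := hu ε hε
    refine ⟨N, fun m hm n hn => lt_of_le_of_lt ?_ (hN m hm n hn)⟩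
    rw [dist_eq_norm, dist_eq_norm, ← map_sub]
    exact norm_toCLM_le _
  obtain ⟨A, hA⟩ := cauchySeq_tendsto_of_complete hu'
  have hcomp : IsCompactOperator A :=
    isCompactOperator_of_tendsto hA (.of_forall fun n => (u n).isCompactOperator)
  have hclose : ∀ ε : ℝ, 0 < ε → ∃ N, ∀ n ≥ N,
      traceENorm (A - toCLM H (u n)) ≤ ENNReal.ofReal ε := by
    intro ε hε
    obtain ⟨N, hN⟩ := Metric.cauchySeq_iff.1 hu ε hε
    refine ⟨N, fun n hn => ?_⟩
    refine (isClosed_traceENorm_le (ENNReal.ofReal ε)).mem_of_tendsto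
      (hA.sub_const (toCLM H (u n))) ?_
    filter_upwards [Filter.eventually_ge_atTop N] with m hm
    have h1 := (hN m hm n hn).le
    rw [dist_eq_norm, norm_def, map_sub] at h1
    have h2 : traceENorm (toCLM H (u m) - toCLM H (u n)) ≠ ⊤ := by
      rw [← map_sub]; exact (u m - u n).traceENorm_ne_top
    exact (ENNReal.le_ofReal_iff_toReal_le h2 hε.le).2 h1
  have hfin : traceENorm A < ⊤ := by
    obtain ⟨N, hN⟩ := hclose 1 one_pos
    have h1 := traceENorm_add_le (A - toCLM H (u N)) (toCLM H (u N))
    rw [sub_add_cancel] at h1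
    exact h1.trans_lt (ENNReal.add_lt_top.2
      ⟨(hN N le_rfl).trans_lt ENNReal.ofReal_lt_top, (u N).traceENorm_ne_top.lt_top⟩)
  let a : SchattenOne H := (⟨A, hcomp, hfin⟩ : schattenOneSubmodule H)
  have ha : toCLM H a = A := rfl
  refine ⟨a, ?_⟩
  rw [tendsto_iff_norm_sub_tendsto_zero, Metric.tendsto_atTop]
  intro ε hε
  obtain ⟨N, hN⟩ := hclose (ε / 2) (by positivity)
  refine ⟨N, fun n hn => ?_⟩
  have h1 := hN n hn
  have h2 : ‖u n - a‖ ≤ ε / 2 := by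
    rw [norm_sub_rev, norm_def, map_sub, ha]
    exact ENNReal.toReal_le_of_le_ofReal (by positivity) h1
  rw [Real.dist_eq, sub_zero, abs_of_nonneg (norm_nonneg _)]
  linarith

end SchattenOne

end SchattenOne

/-! ### The norms on sequences of operators -/

section SequenceNorms

variable {H : Type*} [NormedAddCommGroup H] [InnerProductSpace ℂ H] [CompleteSpace H]

open Classical in
/-- The column norm `tr √(∑ j, (c j)* (c j)) ∈ [0, ∞]` of a sequence of compact operators.
It is infinite if the series does not converge in operator norm. (If a column of compact operators
has partial sums `∑ j < n, (c j)* (c j)` with bounded `tr √·`, then it is a compact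
operator from `H` to `ℓ²(H)`, and the series does converge in operator norm.) -/
noncomputable def columnNorm (c : ℕ → H →L[ℂ] H) : ℝ≥0∞ :=
  if Summable (fun j => star (c j) * c j) then
    opTrace (CFC.sqrt (∑' j, star (c j) * c j))
  else ⊤

/-- The splitting norm: the infimum of `‖(a j)‖ + ‖((b j)*)‖`, in the column norm, over all
splittings `c = a + b` into sequences of compact operators. -/
noncomputable def splittingNorm (c : ℕ → H →L[ℂ] H) : ℝ≥0∞ :=
  ⨅ (a : ℕ → H →L[ℂ] H) (b : ℕ → H →L[ℂ] H)
    (_ : ∀ j, IsCompactOperator (a j)) (_ : ∀ j, IsCompactOperator (b j))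
    (_ : ∀ j, c j = a j + b j),
    columnNorm a + columnNorm (fun j => star (b j))

end SequenceNorms

/-! ### Lacunary sequences and the circle -/

/-- The sequence `k` enumerates a strongly lacunary set of nonnegative integers. -/
def IsStronglyLacunary (k : ℕ → ℕ) : Prop :=
  ∀ j, 2 * k j < k (j + 1)

instance fact_two_pi_pos : Fact (0 < 2 * Real.pi) := ⟨Real.two_pi_pos⟩

/-! The proof is by duality and gives the constant 2. For a finite sequence `c` in the Schatten
class, Hahn–Banach gives a functional that attains the splitting norm at `c` and is dominated by it.
On operators of rank one it has the form `tr (d j * A)`. Testing the two halves of the splitting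
norm separately shows that `d` is contractive both as a column and as a row: `∑ d_j* d_j ≤ 1` and `∑
d_j d_j* ≤ 1` (`operator_contractive_of_le_splittingSeminorm`).

It remains to bound `∑ tr (d_j c_j)` by `2 ‖f‖₁`, where `f = ∑ e^{i k_j t} c_j`. Were the `d_j` the
coefficients of an operator-valued function bounded by 2, this would follow from the duality of
trace norm and operator norm. Such a function is produced approximately. Put `x = ∑ e^{-i k_j t}
d_j` and truncate it to the contraction `y = 2x(2 + x*x)⁻¹`. The error `r = x - y` satisfies `8 r*r
≤ (x*x)²`. Strong lacunarity makes the nonzero differences of the `k_j` distinct, so orthogonality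
gives `∫ (x*x)² ≤ 2`, and Bessel's inequality shows that twice the coefficients of `r` again form a
contractive column; by taking adjoints, also a contractive row. Hence the pairing with `d` is at
most `‖f‖₁` plus half the pairing with another admissible sequence, and iteration sums `1 + 1/2 +
1/4 + ...` (`re_sum_traceOn_le_add`, `re_sum_traceOn_le`).

The general case follows by density. Fejér means preserve the spectrum and converge in `L¹`, and
coefficients in `S₁` are approximated by operators living on finitely many basis vectors. A general
`f` is then a series of such polynomials whose norms add up to almost `‖f‖`, and the splitting norm
is countably subadditive (`splittingNorm_hasSum_le`). -/

open MeasureTheory AddCircle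

/-! ### Columns over a C⋆-algebra -/

section Columns

variable {A : Type*} [CStarAlgebra A] [PartialOrder A] [StarOrderedRing A]

/-- The norm of the column `(a j)`, for `j` in a finite set. -/
noncomputable def finsetColumnNorm {ι : Type*} (J : Finset ι) (a : ι → A) : ℝ :=
  √‖∑ j ∈ J, star (a j) * a j‖

omit [PartialOrder A] [StarOrderedRing A] in
theorem finsetColumnNorm_nonneg {ι : Type*} (J : Finset ι) (a : ι → A) :
    0 ≤ finsetColumnNorm J a :=
  Real.sqrt_nonneg _

omit [PartialOrder A] [StarOrderedRing A] in
theorem sq_finsetColumnNorm {ι : Type*} (J : Finset ι) (a : ι → A) :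
    finsetColumnNorm J a ^ 2 = ‖∑ j ∈ J, star (a j) * a j‖ :=
  Real.sq_sqrt (norm_nonneg _)

/-- Identifies the column norm with the norm of a Hilbert C⋆-module, which yields the triangle
inequality. The stars are there because the inner square of `x` in that module is `x * star x`. -/
theorem norm_toPi_star {ι : Type*} (J : Finset ι) (a : ι → A) :
    ‖(WithCStarModule.equiv A (J → A)).symm fun j => star (a j)‖ = finsetColumnNorm J a := by
  rw [WithCStarModule.pi_norm, finsetColumnNorm, ← Finset.sum_coe_sort J]
  simp [WithCStarModule.inner_def]

theorem finsetColumnNorm_sum_le {ι κ : Type*} (J : Finset ι) (s : Finset κ) (a : κ → ι → A) :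
    finsetColumnNorm J (fun j => ∑ i ∈ s, a i j) ≤ ∑ i ∈ s, finsetColumnNorm J (a i) := by
  simp_rw [← norm_toPi_star]
  refine (le_of_eq ?_).trans (norm_sum_le s _)
  congr 1
  apply (WithCStarModule.equiv A (J → A)).injective
  funext j
  have : ∀ t : Finset κ, (WithCStarModule.equiv A (J → A))
      (∑ i ∈ t, (WithCStarModule.equiv A (J → A)).symm fun j : J => star (a i j)) =
        ∑ i ∈ t, fun j : J => star (a i j) := fun t =>
    map_sum (WithCStarModule.linearEquiv ℂ A (J → A)) _ t
  rw [this]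
  simp

omit [PartialOrder A] [StarOrderedRing A] in
theorem continuous_finsetColumnNorm {ι : Type*} (J : Finset ι) :
    Continuous (finsetColumnNorm J : (ι → A) → ℝ) := by
  unfold finsetColumnNorm
  fun_prop

theorem tsum_star_mul_self_nonneg {ι : Type*} (a : ι → A) : 0 ≤ ∑' j, star (a j) * a j :=
  tsum_nonneg fun j => star_mul_self_nonneg (a j)

theorem sum_star_mul_self_nonneg {ι : Type*} (J : Finset ι) (a : ι → A) :
    0 ≤ ∑ j ∈ J, star (a j) * a j :=
  Finset.sum_nonneg fun j _ => star_mul_self_nonneg (a j)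

theorem sum_star_mul_self_le_tsum {ι : Type*} {a : ι → A} (h : Summable fun j => star (a j) * a j)
    (J : Finset ι) : ∑ j ∈ J, star (a j) * a j ≤ ∑' j, star (a j) * a j :=
  h.sum_le_tsum J fun j _ => star_mul_self_nonneg (a j)

/-- The Cauchy–Schwarz inequality for the product of a row contraction and a column. -/
theorem star_sum_mul_self_le {ι : Type*} (J : Finset ι) (V a : ι → A)
    (hV : ∑ j ∈ J, V j * star (V j) ≤ 1) :
    star (∑ j ∈ J, V j * a j) * (∑ j ∈ J, V j * a j) ≤ ∑ j ∈ J, star (a j) * a j := by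
  set S := ∑ j ∈ J, V j * a j with hS
  -- Completing the square: `a` is compared with the column of all `V_j* S`. Expanding gives `∑ a_j*
  -- a_j - 2 S*S + S*(∑ V_j V_j*)S`, and the last term is at most `S*S`.
  have h0 : 0 ≤ ∑ j ∈ J, star (a j - star (V j) * S) * (a j - star (V j) * S) :=
    Finset.sum_nonneg fun j _ => star_mul_self_nonneg _
  have h1 : ∑ j ∈ J, star (a j - star (V j) * S) * (a j - star (V j) * S) =
      ∑ j ∈ J, star (a j) * a j - star S * S - star S * S
        + star S * (∑ j ∈ J, V j * star (V j)) * S := by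
    have e : ∀ j, star (a j - star (V j) * S) * (a j - star (V j) * S) =
        star (a j) * a j - star (V j * a j) * S - star S * (V j * a j)
          + star S * (V j * star (V j)) * S := fun j => by
      simp only [star_sub, star_mul, star_star]
      noncomm_ring
    simp_rw [e]
    rw [Finset.sum_add_distrib, Finset.sum_sub_distrib, Finset.sum_sub_distrib, ← Finset.sum_mul,
      ← Finset.sum_mul, ← Finset.mul_sum, ← Finset.mul_sum, ← star_sum, ← hS]
  have h2 := star_left_conjugate_le_conjugate hV S
  rw [mul_one] at h2
  rw [h1] at h0
  have h3 : 0 ≤ ∑ j ∈ J, star (a j) * a j - star S * S - star S * S + star S * S :=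
    h0.trans (by gcongr)
  rwa [sub_add_cancel, sub_nonneg] at h3

end Columns

/-! ### The column norm: duality with row contractions and countable subadditivity. -/

section ColumnNorm

variable {H : Type*} [NormedAddCommGroup H] [InnerProductSpace ℂ H] [CompleteSpace H]

theorem opTrace_mono {S T : H →L[ℂ] H} (h : S ≤ T) : opTrace S ≤ opTrace T := by
  refine ENNReal.tsum_le_tsum fun i => ENNReal.ofReal_le_ofReal ?_
  have h1 := ((ContinuousLinearMap.nonneg_iff_isPositive _).1
    (sub_nonneg.2 h)).re_inner_nonneg_right (onb H i)
  rw [sub_apply, inner_sub_right] at h1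
  simpa using h1

theorem traceENorm_of_nonneg {P : H →L[ℂ] H} (hP : 0 ≤ P) : traceENorm P = opTrace P := by
  rw [traceENorm, CFC.abs_of_nonneg P hP]

theorem traceENorm_mul_le_of_norm_le_one {B : H →L[ℂ] H} (hB : ‖B‖ ≤ 1) (A : H →L[ℂ] H) :
    traceENorm (B * A) ≤ traceENorm A := by
  rw [traceENorm_le_iff]
  intro V hV F
  rw [← mul_assoc]
  exact (traceENorm_le_iff A _).1 le_rfl (V * B)
    ((norm_mul_le V B).trans (mul_le_one₀ hV (norm_nonneg _) hB)) F

theorem traceENorm_rankOne_le (y u : H) :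
    traceENorm (InnerProductSpace.rankOne ℂ y u) ≤ ‖y‖ₑ * ‖u‖ₑ := by
  rw [traceENorm_le_iff]
  intro V hV F
  rw [← ofReal_norm, ← ofReal_norm, ← ENNReal.ofReal_mul (norm_nonneg _)]
  refine ENNReal.ofReal_le_ofReal ?_
  have h1 : ∀ i ∈ F, (⟪onb H i, (V * InnerProductSpace.rankOne ℂ y u) (onb H i)⟫_ℂ).re ≤
      ‖⟪onb H i, V y⟫_ℂ‖ * ‖⟪onb H i, u⟫_ℂ‖ := by
    intro i _
    refine (Complex.re_le_norm _).trans (le_of_eq ?_)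
    rw [mul_apply_eq_comp, InnerProductSpace.rankOne_apply, map_smul,
      inner_smul_right, norm_mul, norm_inner_symm, mul_comm]
  have h2 : ‖V y‖ ≤ ‖y‖ := (V.le_opNorm y).trans (mul_le_of_le_one_left (norm_nonneg _) hV)
  have h3 := (onb H).orthonormal.sum_inner_products_le (V y) (s := F)
  have h4 := (onb H).orthonormal.sum_inner_products_le u (s := F)
  refine (Finset.sum_le_sum h1).trans
    (abs_le_of_sq_le_sq' ((Finset.sum_mul_sq_le_sq_mul_sq _ _ _).trans ?_) (by positivity)).2
  rw [mul_pow]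
  gcongr
  exact h3.trans (by gcongr)

theorem opTrace_sqrt_eq (T : H →L[ℂ] H) : opTrace (CFC.sqrt T) = traceENorm (CFC.sqrt T) :=
  (traceENorm_of_nonneg (CFC.sqrt_nonneg T)).symm

theorem traceENorm_hasSum_le {ι : Type*} {a : ι → H →L[ℂ] H} {s : H →L[ℂ] H} (h : HasSum a s) :
    traceENorm s ≤ ∑' i, traceENorm (a i) := by
  refine (isClosed_traceENorm_le _).mem_of_tendsto h (.of_forall fun F => ?_)
  refine le_trans ?_ (ENNReal.sum_le_tsum F)
  exact Finset.le_sum_of_subadditive _ traceENorm_zero.le traceENorm_add_le F a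

theorem columnNorm_of_summable {c : ℕ → H →L[ℂ] H} (h : Summable fun j => star (c j) * c j) :
    columnNorm c = opTrace (CFC.sqrt (∑' j, star (c j) * c j)) := if_pos h

theorem columnNorm_of_not_summable {c : ℕ → H →L[ℂ] H}
    (h : ¬ Summable fun j => star (c j) * c j) : columnNorm c = ⊤ := if_neg h

/-- Cauchy–Schwarz bounds `|∑ V_j c_j|²` by `∑ c_j* c_j`, and the square root is operator monotone.
With `columnNorm_le_of_forall` as converse, the column norm becomes a supremum of trace norms of
linear images, from which subadditivity is read off. -/
theorem traceENorm_sum_mul_le_columnNorm (c V : ℕ → H →L[ℂ] H) (J : Finset ℕ)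
    (hV : ∑ j ∈ J, V j * star (V j) ≤ 1) :
    traceENorm (∑ j ∈ J, V j * c j) ≤ columnNorm c := by
  by_cases h : Summable fun j => star (c j) * c j
  · rw [columnNorm_of_summable h, traceENorm]
    exact opTrace_mono (CFC.sqrt_le_sqrt _ _
      ((star_sum_mul_self_le J V c hV).trans (sum_star_mul_self_le_tsum h J)))
  · rw [columnNorm_of_not_summable h]; exact le_top

theorem finsetColumnNorm_le_columnNorm (c : ℕ → H →L[ℂ] H) (J : Finset ℕ) :
    ENNReal.ofReal (finsetColumnNorm J c) ≤ columnNorm c := by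
  by_cases h : Summable fun j => star (c j) * c j
  · have h0 : 0 ≤ ∑' j, star (c j) * c j := tsum_star_mul_self_nonneg c
    rw [columnNorm_of_summable h, opTrace_sqrt_eq]
    refine le_trans ?_ (enorm_le_traceENorm _)
    rw [← ofReal_norm, CFC.norm_sqrt _ h0]
    refine ENNReal.ofReal_le_ofReal (Real.sqrt_le_sqrt
      (CStarAlgebra.norm_le_norm_of_nonneg_of_le (sum_star_mul_self_nonneg J c)
        (sum_star_mul_self_le_tsum h J)))
  · rw [columnNorm_of_not_summable h]; exact le_top

theorem enorm_le_columnNorm (c : ℕ → H →L[ℂ] H) (j : ℕ) : ‖c j‖ₑ ≤ columnNorm c := by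
  have h := finsetColumnNorm_le_columnNorm c {j}
  rwa [finsetColumnNorm, Finset.sum_singleton, CStarRing.norm_star_mul_self,
    Real.sqrt_mul_self (norm_nonneg _), ofReal_norm] at h

/-- `G = (P + ε)⁻¹` is a regularised inverse of `P`; it replaces the polar decomposition when `P` is
not invertible. -/
theorem exists_mul_sq_approx {P : H →L[ℂ] H} (hP : 0 ≤ P) {ε : ℝ} (hε : 0 < ε) :
    ∃ G : H →L[ℂ] H, star G = G ∧ G * (P * P) * G ≤ 1 ∧ ‖P - G * (P * P)‖ ≤ ε := by
  have hsp : ∀ x ∈ spectrum ℝ P, 0 ≤ x := fun x hx => spectrum_nonneg_of_nonneg hP hx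
  have hg : ContinuousOn (fun x : ℝ => (x + ε)⁻¹) (spectrum ℝ P) :=
    ContinuousOn.inv₀ (by fun_prop) fun x hx => by have := hsp x hx; positivity
  set G := cfc (fun x : ℝ => (x + ε)⁻¹) P with hG
  have hid : cfc (fun x : ℝ => x) P = P := cfc_id' ℝ P
  have c0 : ContinuousOn (fun x : ℝ => x * x) (spectrum ℝ P) := by fun_prop
  have c1 : ContinuousOn (fun x : ℝ => (x + ε)⁻¹ * (x * x)) (spectrum ℝ P) := hg.mul c0
  have hPP : P * P = cfc (fun x : ℝ => x * x) P := by
    rw [cfc_mul (fun x : ℝ => x) (fun x : ℝ => x) P continuousOn_id continuousOn_id, hid]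
  have hGPP : G * (P * P) = cfc (fun x : ℝ => (x + ε)⁻¹ * (x * x)) P := by
    rw [cfc_mul _ _ P hg c0, ← hPP]
  refine ⟨G, (cfc_predicate (fun x : ℝ => (x + ε)⁻¹) P : IsSelfAdjoint _).star_eq, ?_, ?_⟩
  · rw [hGPP, hG, ← cfc_mul (fun x : ℝ => (x + ε)⁻¹ * (x * x)) (fun x : ℝ => (x + ε)⁻¹) P c1 hg]
    refine cfc_le_one _ P fun x hx => ?_
    have h0 := hsp x hx
    rw [inv_mul_eq_div, ← div_eq_mul_inv, div_div, div_le_one (by positivity)]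
    nlinarith
  · have : P - G * (P * P) = cfc (fun x : ℝ => x - (x + ε)⁻¹ * (x * x)) P := by
      rw [cfc_sub (fun x : ℝ => x) (fun x : ℝ => (x + ε)⁻¹ * (x * x)) P continuousOn_id c1, ← hGPP, hid]
    rw [this]
    refine norm_cfc_le hε.le fun x hx => ?_
    have h0 := hsp x hx
    have : x - (x + ε)⁻¹ * (x * x) = ε * x / (x + ε) := by
      field_simp
      ring
    rw [this, Real.norm_of_nonneg (by positivity), div_le_iff₀ (by positivity)]
    nlinarith

/-- A bound for the column norm by testing against row contractions. -/
theorem columnNorm_le_of_forall {c : ℕ → H →L[ℂ] H} (h : Summable fun j => star (c j) * c j)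
    (M : ℝ≥0∞) (hM : ∀ (J : Finset ℕ) (V : ℕ → H →L[ℂ] H), ∑ j ∈ J, V j * star (V j) ≤ 1 →
      traceENorm (∑ j ∈ J, V j * c j) ≤ M) : columnNorm c ≤ M := by
  have h0 : 0 ≤ ∑' j, star (c j) * c j := tsum_star_mul_self_nonneg c
  rw [columnNorm_of_summable h, opTrace_sqrt_eq]
  set T := ∑' j, star (c j) * c j with hT
  set P := CFC.sqrt T with hP
  have hPP : P * P = T := CFC.sqrt_mul_sqrt_self T h0
  have key : ∀ G : H →L[ℂ] H, star G = G → G * T * G ≤ 1 → traceENorm (G * T) ≤ M := by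
    intro G hG hG1
    refine (isClosed_traceENorm_le M).mem_of_tendsto (h.hasSum.mul_left G)
      (.of_forall fun J => ?_)
    change traceENorm _ ≤ M
    simp_rw [← mul_assoc]
    -- With `G` close to `P⁻¹`, the row `G c_j*` is almost extremal: it is contractive because `G T
    -- G ≤ 1`, and it sends the column to partial sums of `G T`, which is close to `P = √T`.
    refine hM J (fun j => G * star (c j)) (le_trans ?_ hG1)
    have e : ∑ j ∈ J, G * star (c j) * star (G * star (c j)) =
        star G * (∑ j ∈ J, star (c j) * c j) * G := by
      rw [Finset.mul_sum, Finset.sum_mul]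
      refine Finset.sum_congr rfl fun j _ => ?_
      rw [star_mul, star_star, hG]
      simp only [mul_assoc]
    rw [e]
    have := star_left_conjugate_le_conjugate (sum_star_mul_self_le_tsum h J) G
    rwa [hG] at this ⊢
  have hcl : P ∈ closure {A : H →L[ℂ] H | traceENorm A ≤ M} := by
    rw [Metric.mem_closure_iff]
    intro ε hε
    obtain ⟨G, hG, hG1, hG2⟩ := exists_mul_sq_approx (CFC.sqrt_nonneg T) (half_pos hε)
    rw [← hP, hPP] at hG1 hG2
    refine ⟨G * T, key G hG hG1, ?_⟩
    rw [dist_eq_norm]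
    linarith
  rwa [(isClosed_traceENorm_le M).closure_eq] at hcl

/-- The column norm is infinite by definition when the series of squares diverges, so norm
convergence for the sum has to be secured before any estimate. The tails of `s` are dominated by the
sum of the tails of the `a i`. -/
theorem summable_star_mul_self_of_hasSum {a : ℕ → ℕ → H →L[ℂ] H} {s : ℕ → H →L[ℂ] H}
    (h : ∀ j, HasSum (fun i => a i j) (s j)) (hfin : ∑' i, columnNorm (a i) ≠ ⊤) :
    Summable fun j => star (s j) * s j := by
  have hi : ∀ i, columnNorm (a i) ≠ ⊤ := fun i => ENNReal.ne_top_of_tsum_ne_top hfin i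
  have hle : ∀ i J, finsetColumnNorm J (a i) ≤ (columnNorm (a i)).toReal := fun i J =>
    (ENNReal.ofReal_le_iff_le_toReal (hi i)).1 (finsetColumnNorm_le_columnNorm _ _)
  have hsum : Summable fun i => (columnNorm (a i)).toReal := ENNReal.summable_toReal hfin
  have hnn := fun (J : Finset ℕ) i => finsetColumnNorm_nonneg J (a i)
  have hsJ : ∀ J, Summable fun i => finsetColumnNorm J (a i) := fun J =>
    .of_nonneg_of_le (hnn J) (fun i => hle i J) hsum
  have hJ : ∀ J, finsetColumnNorm J s ≤ ∑' i, finsetColumnNorm J (a i) := by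
    intro J
    have h1 : HasSum a s := Pi.hasSum.2 h
    refine le_of_tendsto (((continuous_finsetColumnNorm J).tendsto s).comp h1)
      (.of_forall fun F => ?_)
    have h2 := finsetColumnNorm_sum_le J F a
    have e : (fun j => ∑ i ∈ F, a i j) = ∑ i ∈ F, a i := by ext1 j; simp
    rw [e] at h2
    exact h2.trans ((hsJ J).sum_le_tsum F fun i _ => hnn J i)
  have hsi : ∀ i, Summable fun j => star (a i j) * a i j := fun i => by
    by_contra hns
    exact hi i (columnNorm_of_not_summable hns)
  rw [summable_iff_vanishing_norm]
  intro ε hε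
  have hε2 : 0 < √ε := Real.sqrt_pos.2 hε
  -- Half of `√ε` is spent on the columns outside a finite set `F`, uniformly in `J`. The other half
  -- is shared by the finitely many columns in `F`, whose own series have small tails.
  obtain ⟨F, hF⟩ := ((tendsto_tsum_compl_atTop_zero fun i => (columnNorm (a i)).toReal).eventually
    (gt_mem_nhds (half_pos hε2))).exists
  have hδ : 0 < √ε / 2 / (F.card + 1) := by positivity
  choose S hS using fun i => summable_iff_vanishing_norm.1 (hsi i)
    ((√ε / 2 / (F.card + 1)) ^ 2) (by positivity)
  refine ⟨F.biUnion S, fun J hdisj => ?_⟩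
  have h1 : ∑ i ∈ F, finsetColumnNorm J (a i) ≤ √ε / 2 := by
    have : ∀ i ∈ F, finsetColumnNorm J (a i) ≤ √ε / 2 / (F.card + 1) := fun i hiF => by
      refine (abs_le_of_sq_le_sq' ?_ hδ.le).2
      rw [sq_finsetColumnNorm]
      exact (hS i J (hdisj.mono_right (Finset.subset_biUnion_of_mem S hiF))).le
    refine (Finset.sum_le_card_nsmul _ _ _ this).trans ?_
    rw [nsmul_eq_mul, mul_div_assoc', div_le_iff₀ (by positivity)]
    nlinarith [Real.sqrt_nonneg ε]
  have h2 : finsetColumnNorm J s < √ε := by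
    refine (hJ J).trans_lt ?_
    rw [← (hsJ J).sum_add_tsum_subtype_compl F]
    have h3 : ∑' i : {i // i ∉ F}, finsetColumnNorm J (a i) ≤
        ∑' i : {i // i ∉ F}, (columnNorm (a i)).toReal :=
      ((hsJ J).subtype _).tsum_le_tsum (fun i => hle i J) (hsum.subtype _)
    linarith
  rw [← sq_finsetColumnNorm, ← Real.sq_sqrt hε.le]
  gcongr
  exact finsetColumnNorm_nonneg _ _

/-- The column norm is countably subadditive. -/
theorem columnNorm_hasSum_le {a : ℕ → ℕ → H →L[ℂ] H} {s : ℕ → H →L[ℂ] H}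
    (h : ∀ j, HasSum (fun i => a i j) (s j)) : columnNorm s ≤ ∑' i, columnNorm (a i) := by
  by_cases hfin : ∑' i, columnNorm (a i) = ⊤
  · rw [hfin]; exact le_top
  refine columnNorm_le_of_forall (summable_star_mul_self_of_hasSum h hfin) _ fun J V hV => ?_
  have h1 : HasSum (fun i => ∑ j ∈ J, V j * a i j) (∑ j ∈ J, V j * s j) :=
    hasSum_sum fun j _ => (h j).mul_left (V j)
  exact (traceENorm_hasSum_le h1).trans
    (ENNReal.tsum_le_tsum fun i => traceENorm_sum_mul_le_columnNorm _ _ _ hV)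

theorem columnNorm_zero : columnNorm (fun _ => (0 : H →L[ℂ] H)) = 0 := by
  rw [columnNorm_of_summable (by simp)]
  simp [opTrace]

theorem columnNorm_smul_le (z : ℂ) (c : ℕ → H →L[ℂ] H) :
    columnNorm (fun j => z • c j) ≤ ‖z‖ₑ * columnNorm c := by
  by_cases hz : z = 0
  · simp [hz, columnNorm_zero]
  by_cases h : Summable fun j => star (c j) * c j
  · refine columnNorm_le_of_forall ?_ _ fun J V hV => ?_
    · have := h.const_smul (star z * z)
      simpa [star_smul, smul_smul, mul_comm] using this
    · have e : ∑ j ∈ J, V j * z • c j = z • ∑ j ∈ J, V j * c j := by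
        simp [Finset.smul_sum]
      rw [e, traceENorm_smul]
      gcongr
      exact traceENorm_sum_mul_le_columnNorm _ _ _ hV
  · rw [columnNorm_of_not_summable h, ENNReal.mul_top (by simpa using hz)]
    exact le_top

end ColumnNorm

/-! ### The splitting norm: elementary estimates and countable subadditivity. -/

section SplittingNorm

variable {H : Type*} [NormedAddCommGroup H] [InnerProductSpace ℂ H] [CompleteSpace H]

theorem sum_star_mul_self_le_one_iff {ι : Type*} (J : Finset ι) (a : ι → H →L[ℂ] H) :
    ∑ j ∈ J, star (a j) * a j ≤ 1 ↔ ∀ u, ∑ j ∈ J, ‖a j u‖ ^ 2 ≤ ‖u‖ ^ 2 := by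
  have e : ∀ u, (⟪(1 - ∑ j ∈ J, star (a j) * a j) u, u⟫_ℂ) =
      ((‖u‖ ^ 2 - ∑ j ∈ J, ‖a j u‖ ^ 2 : ℝ) : ℂ) := by
    intro u
    simp only [sub_apply, one_apply_eq_self, inner_sub_left, sum_apply,
      sum_inner, mul_apply_eq_comp, ContinuousLinearMap.star_eq_adjoint,
      ContinuousLinearMap.adjoint_inner_left, inner_self_eq_norm_sq_to_K]
    push_cast
    rfl
  rw [ContinuousLinearMap.le_def, ContinuousLinearMap.isPositive_iff_complex]
  refine forall_congr' fun u => ?_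
  rw [e, RCLike.re_to_complex, Complex.ofReal_re]
  exact ⟨fun h => sub_nonneg.1 h.2, fun h => ⟨rfl, sub_nonneg.2 h⟩⟩

/-- A contractive row maps `⊕ H` to `H` with norm at most 1, since its adjoint `S ↦ (V_j* S)` is a
contraction. -/
theorem norm_sum_apply_le_of_row {ι : Type*} (J : Finset ι) (V : ι → H →L[ℂ] H)
    (hV : ∑ j ∈ J, V j * star (V j) ≤ 1) (x : ι → H) :
    ‖∑ j ∈ J, V j (x j)‖ ≤ √(∑ j ∈ J, ‖x j‖ ^ 2) := by
  set S := ∑ j ∈ J, V j (x j) with hS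
  have h1 : ∑ j ∈ J, ‖star (V j) S‖ ^ 2 ≤ ‖S‖ ^ 2 := by
    refine (sum_star_mul_self_le_one_iff J fun j => star (V j)).1 ?_ S
    simpa using hV
  have h2 : ‖S‖ ^ 2 ≤ ∑ j ∈ J, ‖star (V j) S‖ * ‖x j‖ := by
    rw [← inner_self_eq_norm_sq (𝕜 := ℂ) S]
    conv_lhs => rw [hS, sum_inner, map_sum]
    refine Finset.sum_le_sum fun j _ => ?_
    rw [← ContinuousLinearMap.adjoint_inner_right, ← ContinuousLinearMap.star_eq_adjoint, mul_comm]
    exact re_inner_le_norm _ _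
  have h3 := Finset.sum_mul_sq_le_sq_mul_sq J (fun j => ‖star (V j) S‖) fun j => ‖x j‖
  refine Real.le_sqrt_of_sq_le ?_
  have h4 : (‖S‖ ^ 2) ^ 2 ≤ ‖S‖ ^ 2 * ∑ j ∈ J, ‖x j‖ ^ 2 :=
    (pow_le_pow_left₀ (by positivity) h2 2).trans (h3.trans (by gcongr))
  by_cases h0 : ‖S‖ ^ 2 = 0
  · rw [h0]; positivity
  · have : 0 < ‖S‖ ^ 2 := lt_of_le_of_ne (by positivity) (Ne.symm h0)
    nlinarith

theorem summable_star_mul_self_of_support {c : ℕ → H →L[ℂ] H} {J : Finset ℕ}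
    (h : ∀ j ∉ J, c j = 0) : Summable fun j => star (c j) * c j :=
  summable_of_ne_finset_zero (s := J) fun j hj => by simp [h j hj]

/-- A row applied to rank-one operators with a common `u` gives one rank-one operator with the same
`u`. These columns are the test sequences for the dual functional. -/
theorem columnNorm_rankOne_le (J : Finset ℕ) (x : ℕ → H) (hx : ∀ j ∉ J, x j = 0) (u : H) :
    columnNorm (fun j => InnerProductSpace.rankOne ℂ (x j) u) ≤
      ENNReal.ofReal (√(∑ j ∈ J, ‖x j‖ ^ 2) * ‖u‖) := by
  refine columnNorm_le_of_forall
    (summable_star_mul_self_of_support (J := J) fun j hj => by simp [hx j hj]) _ fun I V hV => ?_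
  have e : ∑ j ∈ I, V j * InnerProductSpace.rankOne ℂ (x j) u =
      InnerProductSpace.rankOne ℂ (∑ j ∈ I, V j (x j)) u := by
    ext z
    simp
  rw [e]
  refine (traceENorm_rankOne_le _ _).trans ?_
  rw [← ofReal_norm, ← ofReal_norm, ← ENNReal.ofReal_mul (norm_nonneg _)]
  gcongr
  refine (norm_sum_apply_le_of_row I V hV x).trans (Real.sqrt_le_sqrt ?_)
  have h0 : ∑ j ∈ I, ‖x j‖ ^ 2 = ∑ j ∈ I with j ∈ J, ‖x j‖ ^ 2 := by
    rw [Finset.sum_filter]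
    refine Finset.sum_congr rfl fun j _ => ?_
    split_ifs with hj
    · rfl
    · simp [hx j hj]
  rw [h0]
  exact Finset.sum_le_sum_of_subset_of_nonneg (fun j hj => (Finset.mem_filter.1 hj).2)
    fun _ _ _ => by positivity

theorem columnNorm_single_le (j : ℕ) (A : H →L[ℂ] H) :
    columnNorm (Pi.single j A : ℕ → H →L[ℂ] H) ≤ traceENorm A := by
  have h0 : ∀ i, i ≠ j → (Pi.single j A : ℕ → H →L[ℂ] H) i = 0 := fun i hi => by
    simp [hi]
  refine columnNorm_le_of_forall (summable_star_mul_self_of_support (J := {j}) fun i hi => ?_) _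
    fun J V hV => ?_
  · exact h0 i (by simpa using hi)
  by_cases hj : j ∈ J
  · have e : ∑ i ∈ J, V i * (Pi.single j A : ℕ → H →L[ℂ] H) i = V j * A := by
      rw [Finset.sum_eq_single_of_mem j hj fun i _ hi => by rw [h0 i hi, mul_zero],
        Pi.single_eq_same]
    rw [e]
    refine traceENorm_mul_le_of_norm_le_one ?_ A
    have h1 : V j * star (V j) ≤ 1 := by
      refine le_trans ?_ hV
      have := sum_star_mul_self_nonneg (J.erase j) fun i => star (V i)
      rw [← Finset.add_sum_erase J _ hj]
      simpa using this
    have h2 : ‖V j * star (V j)‖ ≤ 1 :=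
      (CStarAlgebra.norm_le_one_iff_of_nonneg _ (mul_star_self_nonneg (V j))).2 h1
    rw [CStarRing.norm_self_mul_star] at h2
    nlinarith [norm_nonneg (V j)]
  · have e : ∑ i ∈ J, V i * (Pi.single j A : ℕ → H →L[ℂ] H) i = 0 :=
      Finset.sum_eq_zero fun i hi => by
        rw [h0 i fun h => hj (h ▸ hi), mul_zero]
    rw [e, traceENorm_zero]
    exact zero_le

theorem splittingNorm_le {c a b : ℕ → H →L[ℂ] H} (ha : ∀ j, IsCompactOperator (a j))
    (hb : ∀ j, IsCompactOperator (b j)) (h : ∀ j, c j = a j + b j) :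
    splittingNorm c ≤ columnNorm a + columnNorm fun j => star (b j) :=
  iInf_le_of_le a <| iInf_le_of_le b <| iInf_le_of_le ha <| iInf_le_of_le hb <| iInf_le _ h

theorem exists_splitting_lt {c : ℕ → H →L[ℂ] H} {M : ℝ≥0∞} (h : splittingNorm c < M) :
    ∃ a b : ℕ → H →L[ℂ] H, (∀ j, IsCompactOperator (a j)) ∧ (∀ j, IsCompactOperator (b j)) ∧
      (∀ j, c j = a j + b j) ∧ columnNorm a + columnNorm (fun j => star (b j)) < M := by
  simpa only [splittingNorm, iInf_lt_iff, exists_prop] using h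

theorem splittingNorm_le_columnNorm {c : ℕ → H →L[ℂ] H} (hc : ∀ j, IsCompactOperator (c j)) :
    splittingNorm c ≤ columnNorm c := by
  have := splittingNorm_le (c := c) (b := fun _ => 0) hc (fun _ => isCompactOperator_zero)
    fun j => (add_zero _).symm
  simpa [columnNorm_zero] using this

theorem splittingNorm_le_columnNorm_star {c : ℕ → H →L[ℂ] H}
    (hc : ∀ j, IsCompactOperator (c j)) :
    splittingNorm c ≤ columnNorm fun j => star (c j) := by
  have := splittingNorm_le (c := c) (a := fun _ => 0) (fun _ => isCompactOperator_zero) hc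
    fun j => (zero_add _).symm
  simpa [columnNorm_zero] using this

theorem splittingNorm_zero : splittingNorm (fun _ => (0 : H →L[ℂ] H)) = 0 :=
  le_antisymm ((splittingNorm_le_columnNorm fun _ => isCompactOperator_zero).trans
    columnNorm_zero.le) zero_le

theorem splittingNorm_smul_le (z : ℂ) (c : ℕ → H →L[ℂ] H) :
    splittingNorm (fun j => z • c j) ≤ ‖z‖ₑ * splittingNorm c := by
  by_cases hz : z = 0
  · simp [hz, splittingNorm_zero]
  have hz' : ‖z‖ₑ ≠ 0 := by simpa using hz
  have hz'' : ‖z‖ₑ ≠ ⊤ := by finiteness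
  rw [mul_comm, ← ENNReal.div_le_iff_le_mul (.inl hz') (.inl hz'')]
  refine le_of_forall_gt fun M hM => ?_
  obtain ⟨a, b, ha, hb, hab, hlt⟩ := exists_splitting_lt hM
  refine lt_of_le_of_lt ?_ hlt
  rw [ENNReal.div_le_iff_le_mul (.inl hz') (.inl hz''), mul_comm, mul_add]
  refine (splittingNorm_le (a := fun j => z • a j) (b := fun j => z • b j)
    (fun j => (ha j).smul z) (fun j => (hb j).smul z) fun j => ?_).trans ?_
  · rw [hab, smul_add]
  · refine add_le_add (columnNorm_smul_le z a) ?_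
    have := columnNorm_smul_le (star z) fun j => star (b j)
    simpa [star_smul] using this

/-- The splitting norm is countably subadditive. -/
theorem splittingNorm_hasSum_le {c : ℕ → ℕ → H →L[ℂ] H} {s : ℕ → H →L[ℂ] H}
    (h : ∀ j, HasSum (fun i => c i j) (s j)) : splittingNorm s ≤ ∑' i, splittingNorm (c i) := by
  by_cases hfin : ∑' i, splittingNorm (c i) = ⊤
  · rw [hfin]; exact le_top
  refine le_of_forall_pos_le_add fun ε hε => ?_
  -- Each `c i` is split with an error `δ i`, the errors adding up to less than `ε`. The two
  -- families of pieces are then summed separately; the sums converge in operator norm because the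
  -- column norm dominates each entry, so their limits remain compact.
  obtain ⟨δ, hδ, hδs⟩ := ENNReal.exists_pos_sum_of_countable hε.ne' ℕ
  choose a b ha hb hab hlt using fun i => exists_splitting_lt
    (ENNReal.lt_add_right (ENNReal.ne_top_of_tsum_ne_top hfin i)
      (ENNReal.coe_ne_zero.2 (hδ i).ne'))
  have hbound : ∑' i, (columnNorm (a i) + columnNorm fun j => star (b i j)) ≤
      ∑' i, splittingNorm (c i) + ε := by
    refine (ENNReal.tsum_le_tsum fun i => (hlt i).le).trans ?_
    rw [ENNReal.tsum_add]
    gcongr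
  rw [ENNReal.tsum_add] at hbound
  by_cases hε' : ε = ⊤
  · simp [hε']
  have hne := ne_top_of_le_ne_top (ENNReal.add_ne_top.2 ⟨hfin, hε'⟩) hbound
  rw [ENNReal.add_ne_top] at hne
  have hsum : ∀ d : ℕ → ℕ → H →L[ℂ] H, ∑' i, columnNorm (d i) ≠ ⊤ → ∀ j,
      Summable fun i => d i j := fun d hd j => by
    refine .of_norm_bounded (ENNReal.summable_toReal hd) fun i => ?_
    rw [← ENNReal.ofReal_le_iff_le_toReal (ENNReal.ne_top_of_tsum_ne_top hd i), ofReal_norm]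
    exact enorm_le_columnNorm (d i) j
  have hsa := hsum a hne.1
  have hsb' := hsum (fun i j => star (b i j)) hne.2
  have hsb : ∀ j, Summable fun i => b i j := fun j => by simpa using (hsb' j).star
  have hcompact : ∀ d : ℕ → H →L[ℂ] H, (∀ i, IsCompactOperator (d i)) → Summable d →
      IsCompactOperator (∑' i, d i : H →L[ℂ] H) := fun d hd hs => by
    refine isCompactOperator_of_tendsto hs.hasSum (.of_forall fun F => ?_)
    exact Submodule.sum_mem (compactOperator (RingHom.id ℂ) H H) fun i _ => hd i
  refine (splittingNorm_le (a := fun j => ∑' i, a i j) (b := fun j => ∑' i, b i j)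
    (fun j => hcompact _ (fun i => ha i j) (hsa j)) (fun j => hcompact _ (fun i => hb i j) (hsb j))
    fun j => ?_).trans ((add_le_add (columnNorm_hasSum_le fun j => (hsa j).hasSum)
      (columnNorm_hasSum_le (a := fun i j => star (b i j)) fun j => ?_)).trans hbound)
  · rw [← (hsa j).tsum_add (hsb j), ← (h j).tsum_eq]
    exact tsum_congr fun i => hab i j
  · exact (hsb j).hasSum.star

theorem splittingNorm_add_le (c d : ℕ → H →L[ℂ] H) :
    splittingNorm (fun j => c j + d j) ≤ splittingNorm c + splittingNorm d := by
  -- The pair is padded with zeros to an infinite series, so that countable subadditivity applies.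
  set e : ℕ → ℕ → H →L[ℂ] H := fun i => if i = 0 then c else if i = 1 then d else fun _ => 0
    with he
  have he2 : ∀ i ∉ ({0, 1} : Finset ℕ), e i = fun _ => 0 := fun i hi => by
    simp only [Finset.mem_insert, Finset.mem_singleton, not_or] at hi
    simp [he, hi.1, hi.2]
  have h := splittingNorm_hasSum_le (c := e) (s := fun j => c j + d j) fun j => by
    have := hasSum_sum_of_ne_finset_zero (L := .unconditional ℕ) (f := fun i => e i j) (s := {0, 1})
      fun i hi => by rw [he2 i hi]
    simpa [he] using this
  refine h.trans (le_of_eq ?_)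
  rw [tsum_eq_sum (s := {0, 1}) fun i hi => by rw [he2 i hi, splittingNorm_zero]]
  simp [he]

end SplittingNorm

/-! ### Trigonometric sums with coefficients in a C⋆-algebra -/

section TrigSum

variable {T : ℝ} {ι : Type*}

/-- The trigonometric sum `∑ j ∈ J, e^{i φ(j) t} d j`. -/
noncomputable def trigSum {E : Type*} [NormedAddCommGroup E] [NormedSpace ℂ E] (J : Finset ι)
    (φ : ι → ℤ) (d : ι → E) (t : AddCircle T) : E :=
  ∑ j ∈ J, fourier (φ j) t • d j

@[fun_prop]
theorem continuous_trigSum {E : Type*} [NormedAddCommGroup E] [NormedSpace ℂ E] (J : Finset ι)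
    (φ : ι → ℤ) (d : ι → E) : Continuous (trigSum J φ d : AddCircle T → E) := by
  unfold trigSum
  fun_prop

variable [hT : Fact (0 < T)]

theorem Continuous.integrable_haarAddCircle {E : Type*} [NormedAddCommGroup E]
    {f : AddCircle T → E} (hf : Continuous f) : Integrable f haarAddCircle :=
  hf.integrable_of_hasCompactSupport (.of_compactSpace f)

theorem integral_fourier (n : ℤ) :
    ∫ t : AddCircle T, fourier n t ∂haarAddCircle = if n = 0 then 1 else 0 := by
  have h := congrFun (fourierCoeff_fourier (T := T) n) 0
  rw [fourierCoeff] at h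
  simpa [Pi.single_apply, eq_comm] using h

theorem integral_fourier_smul_const {E : Type*} [NormedAddCommGroup E] [NormedSpace ℂ E]
    [CompleteSpace E] (n : ℤ) (v : E) :
    ∫ t : AddCircle T, fourier n t • v ∂haarAddCircle = if n = 0 then v else 0 := by
  rw [integral_smul_const, integral_fourier]
  split_ifs <;> simp

theorem fourierCoeff_trigSum {E : Type*} [NormedAddCommGroup E] [NormedSpace ℂ E]
    [CompleteSpace E] (J : Finset ι) (φ : ι → ℤ) (d : ι → E) (n : ℤ) :
    fourierCoeff (trigSum J φ d : AddCircle T → E) n = ∑ j ∈ J, if φ j = n then d j else 0 := by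
  rw [fourierCoeff]
  simp_rw [trigSum, Finset.smul_sum, smul_smul, ← fourier_add]
  rw [integral_finsetSum]
  · refine Finset.sum_congr rfl fun j _ => ?_
    rw [integral_fourier_smul_const]
    simp [neg_add_eq_zero, eq_comm]
  · exact fun j _ => Continuous.integrable_haarAddCircle (by fun_prop)

theorem fourierCoeff_trigSum_of_injOn {E : Type*} [NormedAddCommGroup E] [NormedSpace ℂ E]
    [CompleteSpace E] {J : Finset ι} {φ : ι → ℤ} (hφ : Set.InjOn φ J) (d : ι → E) {i : ι}
    (hi : i ∈ J) : fourierCoeff (trigSum J φ d : AddCircle T → E) (φ i) = d i := by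
  rw [fourierCoeff_trigSum, Finset.sum_eq_single_of_mem i hi, if_pos rfl]
  exact fun j hj hij => if_neg fun h => hij (hφ hj hi h)

variable {A : Type*} [CStarAlgebra A]

omit hT in
theorem star_trigSum (J : Finset ι) (φ : ι → ℤ) (d : ι → A) (t : AddCircle T) :
    star (trigSum J φ d t) = trigSum J (fun j => -φ j) (fun j => star (d j)) t := by
  simp [trigSum, star_sum, star_smul]

theorem integral_star_comm (f : AddCircle T → A) :
    ∫ t, star (f t) ∂haarAddCircle = star (∫ t, f t ∂haarAddCircle) :=
  (starL' ℝ : A ≃L[ℝ] A).integral_comp_comm f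

theorem star_fourierCoeff (f : AddCircle T → A) (n : ℤ) :
    star (fourierCoeff f n) = fourierCoeff (fun t => star (f t)) (-n) := by
  simp [fourierCoeff, ← integral_star_comm, star_smul]

omit hT in
theorem star_trigSum_mul_self (J : Finset ι) (φ : ι → ℤ) (d : ι → A) (t : AddCircle T) :
    star (trigSum J φ d t) * trigSum J φ d t =
      ∑ p ∈ J ×ˢ J, fourier (φ p.2 - φ p.1) t • (star (d p.1) * d p.2) := by
  rw [star_trigSum, trigSum, trigSum, Finset.sum_mul_sum, Finset.sum_product]
  refine Finset.sum_congr rfl fun i _ => Finset.sum_congr rfl fun j _ => ?_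
  rw [smul_mul_smul_comm, ← fourier_add]
  congr 2
  ring_nf

theorem integral_star_trigSum_mul_self {J : Finset ι} {φ : ι → ℤ} (hφ : Set.InjOn φ J)
    (d : ι → A) :
    ∫ t : AddCircle T, star (trigSum J φ d t) * trigSum J φ d t ∂haarAddCircle =
      ∑ j ∈ J, star (d j) * d j := by
  classical
  simp_rw [star_trigSum_mul_self]
  rw [integral_finsetSum _ fun p _ => Continuous.integrable_haarAddCircle (by fun_prop),
    Finset.sum_product]
  simp_rw [integral_fourier_smul_const, sub_eq_zero]
  refine Finset.sum_congr rfl fun i hi => ?_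
  rw [Finset.sum_eq_single_of_mem i hi, if_pos rfl]
  exact fun j hj hij => if_neg fun h => hij (hφ hj hi h)

variable [PartialOrder A] [StarOrderedRing A]

/-- Bessel's inequality with coefficients in a C⋆-algebra. -/
theorem sum_star_fourierCoeff_mul_self_le {J : Finset ι} {φ : ι → ℤ} (hφ : Set.InjOn φ J)
    {r : AddCircle T → A} (hr : Continuous r) :
    ∑ j ∈ J, star (fourierCoeff r (φ j)) * fourierCoeff r (φ j) ≤
      ∫ t, star (r t) * r t ∂haarAddCircle := by
  set e : ι → A := fun j => fourierCoeff r (φ j) with he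
  set x : AddCircle T → A := trigSum J φ e with hx
  have hxc : Continuous x := continuous_trigSum J φ e
  -- `x` is the projection of `r` onto the given frequencies. Both mixed terms and the square of `x`
  -- integrate to the same sum, so expanding leaves `∫ r*r - ∑ e_j* e_j ≥ 0`.
  have h0 : 0 ≤ ∫ t, star (r t - x t) * (r t - x t) ∂haarAddCircle :=
    integral_nonneg fun t => star_mul_self_nonneg _
  have hxr : ∫ t, star (x t) * r t ∂haarAddCircle = ∑ j ∈ J, star (e j) * e j := by
    have : ∀ t, star (x t) * r t = ∑ j ∈ J, star (e j) * (fourier (-φ j) t • r t) := fun t => by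
      rw [hx, star_trigSum, trigSum, Finset.sum_mul]
      simp
    simp_rw [this]
    rw [integral_finsetSum _ fun p _ => Continuous.integrable_haarAddCircle (by fun_prop)]
    refine Finset.sum_congr rfl fun j _ => ?_
    rw [integral_const_mul_of_integrable]
    · rfl
    · exact Continuous.integrable_haarAddCircle (by fun_prop)
  have hrx : ∫ t, star (r t) * x t ∂haarAddCircle = ∑ j ∈ J, star (e j) * e j := by
    have := integral_star_comm fun t => star (x t) * r t
    rw [hxr] at this
    simpa [star_sum] using this
  have hxx := integral_star_trigSum_mul_self (T := T) hφ e
  have e1 : ∀ t, star (r t - x t) * (r t - x t) =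
      star (r t) * r t - star (r t) * x t - star (x t) * r t + star (x t) * x t := fun t => by
    rw [star_sub]; noncomm_ring
  simp_rw [e1] at h0
  rw [integral_add, integral_sub, integral_sub, hrx, hxr, hxx, sub_add_cancel, sub_nonneg] at h0
  · exact h0
  all_goals exact Continuous.integrable_haarAddCircle (by fun_prop)

/-- The differences of `φ` on `J` are distinct. -/
def DistinctDifferences (J : Finset ι) (φ : ι → ℤ) : Prop :=
  ∀ a ∈ J, ∀ b ∈ J, ∀ c ∈ J, ∀ d ∈ J, a ≠ b → φ a - φ b = φ c - φ d → a = c ∧ b = d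

theorem DistinctDifferences.injOn {J : Finset ι} {φ : ι → ℤ} (h : DistinctDifferences J φ) :
    Set.InjOn φ J := by
  intro a ha b hb hab
  by_contra hne
  exact hne (h a ha b hb b hb a ha hne (by omega)).1

theorem DistinctDifferences.neg {J : Finset ι} {φ : ι → ℤ} (h : DistinctDifferences J φ) :
    DistinctDifferences J fun j => -φ j := fun a ha b hb c hc d hd hab he =>
  h a ha b hb c hc d hd hab (by linarith)

theorem star_mul_self_le_one_of_le_one {a : A} (h0 : 0 ≤ a) (h1 : a ≤ 1) : star a * a ≤ 1 := by
  rw [← CStarAlgebra.norm_le_one_iff_of_nonneg _ (star_mul_self_nonneg a),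
    CStarRing.norm_star_mul_self]
  have := (CStarAlgebra.norm_le_one_iff_of_nonneg a h0).2 h1
  exact mul_le_one₀ this (norm_nonneg _) this

/-- The function `x*x` has constant term `S` and off-diagonal terms at pairwise distinct nonzero
frequencies. Orthogonality turns the integral of its square into `S*S` plus the off-diagonal squares
`d_b* d_a d_a* d_b`; the row bound followed by the column bound shows that each part is at most 1.
-/
theorem integral_sq_star_trigSum_mul_self_le {J : Finset ι} {φ : ι → ℤ}
    (hφ : DistinctDifferences J φ) {d : ι → A} (hcol : ∑ j ∈ J, star (d j) * d j ≤ 1)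
    (hrow : ∑ j ∈ J, d j * star (d j) ≤ 1) :
    ∫ t : AddCircle T, (star (trigSum J φ d t) * trigSum J φ d t) *
      (star (trigSum J φ d t) * trigSum J φ d t) ∂haarAddCircle ≤ 2 := by
  classical
  set S := ∑ j ∈ J, star (d j) * d j with hS
  -- `none` carries the whole diagonal, collected at frequency 0; only after this merging are the
  -- frequencies distinct.
  let ψ : Option (ι × ι) → ℤ := fun o => o.elim 0 fun p => φ p.2 - φ p.1
  let D : Option (ι × ι) → A := fun o => o.elim S fun p => star (d p.1) * d p.2
  have hh : ∀ t : AddCircle T, star (trigSum J φ d t) * trigSum J φ d t =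
      trigSum (Finset.insertNone J.offDiag) ψ D t := by
    intro t
    rw [star_trigSum_mul_self, trigSum, Finset.sum_insertNone, ← Finset.diag_union_offDiag,
      Finset.sum_union (Finset.disjoint_diag_offDiag J), Finset.sum_diag]
    simp [ψ, D, hS]
  have hψ : Set.InjOn ψ (Finset.insertNone J.offDiag : Finset (Option (ι × ι))) := by
    rintro (_ | ⟨a, b⟩) hp (_ | ⟨a', b'⟩) hq h
    · rfl
    · have hq' : a' ∈ J ∧ b' ∈ J ∧ a' ≠ b' := by simpa using hq
      refine absurd (hφ.injOn hq'.1 hq'.2.1 ?_) hq'.2.2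
      have : (0 : ℤ) = φ b' - φ a' := h
      omega
    · have hp' : a ∈ J ∧ b ∈ J ∧ a ≠ b := by simpa using hp
      refine absurd (hφ.injOn hp'.1 hp'.2.1 ?_) hp'.2.2
      have : φ b - φ a = (0 : ℤ) := h
      omega
    · have hp' : a ∈ J ∧ b ∈ J ∧ a ≠ b := by simpa using hp
      have hq' : a' ∈ J ∧ b' ∈ J ∧ a' ≠ b' := by simpa using hq
      obtain ⟨h1, h2⟩ := hφ b hp'.2.1 a hp'.1 b' hq'.2.1 a' hq'.1 hp'.2.2.symm h
      rw [h1, h2]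
  have e1 : ∀ t : AddCircle T, (star (trigSum J φ d t) * trigSum J φ d t) *
      (star (trigSum J φ d t) * trigSum J φ d t) =
      star (trigSum (Finset.insertNone J.offDiag) ψ D t) *
        trigSum (Finset.insertNone J.offDiag) ψ D t := by
    intro t
    rw [← hh, star_mul, star_star]
  simp_rw [e1]
  rw [integral_star_trigSum_mul_self hψ, Finset.sum_insertNone]
  have hoff : ∑ p ∈ J.offDiag, star (D (some p)) * D (some p) ≤ 1 := by
    calc ∑ p ∈ J.offDiag, star (D (some p)) * D (some p)
        ≤ ∑ p ∈ J ×ˢ J, star (D (some p)) * D (some p) := by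
          refine Finset.sum_le_sum_of_subset_of_nonneg ?_ fun p _ _ => star_mul_self_nonneg _
          exact fun p hp => by
            have := Finset.mem_offDiag.1 hp
            exact Finset.mem_product.2 ⟨this.1, this.2.1⟩
      _ = ∑ b ∈ J, star (d b) * (∑ a ∈ J, d a * star (d a)) * d b := by
          rw [Finset.sum_product_right]
          refine Finset.sum_congr rfl fun b _ => ?_
          rw [Finset.mul_sum, Finset.sum_mul]
          refine Finset.sum_congr rfl fun a _ => ?_
          simp only [D, Option.elim, star_mul, star_star, mul_assoc]
      _ ≤ ∑ b ∈ J, star (d b) * d b := by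
          refine Finset.sum_le_sum fun b _ => ?_
          simpa using star_left_conjugate_le_conjugate hrow (d b)
      _ ≤ 1 := hcol
  have hd : star (D none) * D none ≤ 1 :=
    star_mul_self_le_one_of_le_one (sum_star_mul_self_nonneg J d) hcol
  exact (add_le_add hd hoff).trans (by norm_num)

/-! ### Smooth truncation -/

/-- The contraction `2 x (2 + x⋆ x)⁻¹`. -/
noncomputable def truncate (x : A) : A := 2 * x * Ring.inverse (2 + star x * x)

theorem isUnit_two_add_star_mul_self (x : A) : IsUnit (2 + star x * x) := by
  have h : (1 : A) ≤ 2 + star x * x := by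
    have := star_mul_self_nonneg x
    rw [← one_add_one_eq_two]
    have h1 : (0 : A) ≤ 1 := zero_le_one
    rw [add_assoc]
    exact le_add_of_nonneg_right (by positivity)
  exact CStarAlgebra.isUnit_of_le 1 h

theorem continuous_truncate : Continuous (truncate : A → A) := by
  unfold truncate
  refine Continuous.mul (by fun_prop) (continuous_iff_continuousAt.2 fun x => ?_)
  obtain ⟨u, hu⟩ := isUnit_two_add_star_mul_self x
  refine ContinuousAt.comp (g := Ring.inverse) ?_ (by fun_prop)
  rw [← hu]
  exact NormedRing.inverse_continuousAt u

theorem exists_inverse_two_add_star_mul_self (x : A) :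
    ∃ R : A, truncate x = 2 * x * R ∧ star R = R ∧ R * (2 + star x * x) = 1 ∧
      (2 + star x * x) * R = 1 := by
  have h := isUnit_two_add_star_mul_self x
  refine ⟨_, rfl, ?_, Ring.inverse_mul_cancel _ h, Ring.mul_inverse_cancel _ h⟩
  rw [← Ring.inverse_star]
  simp

/-- Truncation commutes with the adjoint because `(2 + x*x)⁻¹ x* = x* (2 + xx*)⁻¹`. Row estimates
thereby reduce to column estimates. -/
theorem truncate_star (x : A) : truncate (star x) = star (truncate x) := by
  obtain ⟨R, h1, h2, h3, -⟩ := exists_inverse_two_add_star_mul_self x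
  obtain ⟨R', h1', -, -, h4'⟩ := exists_inverse_two_add_star_mul_self (star x)
  rw [star_star] at h4'
  have key : R * star x = star x * R' := by
    calc R * star x = R * star x * ((2 + x * star x) * R') := by rw [h4', mul_one]
      _ = R * (2 + star x * x) * (star x * R') := by noncomm_ring
      _ = star x * R' := by rw [h3, one_mul]
  rw [h1, h1', star_mul, star_mul, h2, mul_assoc, ← key, star_ofNat]
  noncomm_ring

theorem star_truncate_mul_self_le (x : A) : star (truncate x) * truncate x ≤ 1 := by
  obtain ⟨R, h1, h2, h3, h4⟩ := exists_inverse_two_add_star_mul_self x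
  set h := star x * x with hh
  have hsa : star h = h := by simp [hh]
  have e1 : star (truncate x) * truncate x = star R * (4 * h) * R := by
    rw [h1, star_mul, star_mul, star_ofNat, hh]
    noncomm_ring
  have e2 : star R * ((2 + h) * (2 + h)) * R = 1 := by
    rw [h2, ← mul_assoc, h3, one_mul, h4]
  rw [e1, ← e2]
  refine star_left_conjugate_le_conjugate ?_ R
  -- Multiplied out by `2 + h` on both sides, the claim reads `4h ≤ (2 + h)²`, with difference `4 +
  -- h²`.
  have h5 : (2 + h) * (2 + h) - 4 * h = star 2 * 2 + star h * h := by
    rw [hsa, star_ofNat]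
    noncomm_ring
  rw [← sub_nonneg, h5]
  exact add_nonneg (star_mul_self_nonneg _) (star_mul_self_nonneg _)

theorem norm_truncate_le (x : A) : ‖truncate x‖ ≤ 1 := by
  have h := (CStarAlgebra.norm_le_one_iff_of_nonneg _ (star_mul_self_nonneg (truncate x))).2
    (star_truncate_mul_self_le x)
  rw [CStarRing.norm_star_mul_self] at h
  nlinarith [norm_nonneg (truncate x)]

theorem star_sub_truncate_mul_self_le (x : A) :
    8 * (star (x - truncate x) * (x - truncate x)) ≤ (star x * x) * (star x * x) := by
  obtain ⟨R, h1, h2, h3, h4⟩ := exists_inverse_two_add_star_mul_self x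
  set h := star x * x with hh
  have hsa : star h = h := by simp [hh]
  have e0 : x - truncate x = x * h * R := by
    calc x - truncate x = x * ((2 + h) * R) - 2 * x * R := by rw [h1, h4, mul_one]
      _ = x * h * R := by noncomm_ring
  have e1 : 8 * (star (x - truncate x) * (x - truncate x)) = star R * (8 * (h * h * h)) * R := by
    rw [e0, star_mul, star_mul, hsa, hh]
    noncomm_ring
  have e2 : star R * (h * (2 + h) * ((2 + h) * h)) * R = h * h := by
    calc star R * (h * (2 + h) * ((2 + h) * h)) * R
        = R * (2 + h) * (h * h) * ((2 + h) * R) := by rw [h2]; noncomm_ring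
      _ = h * h := by rw [h3, h4, one_mul, mul_one]
  rw [e1]
  refine (star_left_conjugate_le_conjugate ?_ R).trans_eq e2
  -- The constant 8 comes from `(2 + h)² - 8h = (2 - h)²`, multiplied by `h²`.
  have h5 : h * (2 + h) * ((2 + h) * h) - 8 * (h * h * h) =
      star ((2 - h) * h) * ((2 - h) * h) := by
    rw [star_mul, star_sub, hsa, star_ofNat]
    noncomm_ring
  rw [← sub_nonneg, h5]
  exact star_mul_self_nonneg _

/-! ### Interpolation up to a factor `1 / 2` -/

/-- The error of truncation keeps the column contractive even after doubling: Bessel bounds the sum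
by `4 ∫ r*r`, and `8 ∫ r*r ≤ ∫ (x*x)² ≤ 2`. -/
theorem sum_star_mul_self_sub_truncate_le {J : Finset ι} {φ : ι → ℤ}
    (hφ : DistinctDifferences J φ) {d : ι → A} (hcol : ∑ j ∈ J, star (d j) * d j ≤ 1)
    (hrow : ∑ j ∈ J, d j * star (d j) ≤ 1) {e : ι → A}
    (he : ∀ j, e j = (2 : ℝ) • (d j -
      fourierCoeff (fun t : AddCircle T => truncate (trigSum J φ d t)) (φ j))) :
    ∑ j ∈ J, star (e j) * e j ≤ 1 := by
  set x : AddCircle T → A := trigSum J φ d with hx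
  have hxc : Continuous x := continuous_trigSum J φ d
  have hyc : Continuous fun t => truncate (x t) := continuous_truncate.comp hxc
  set r : AddCircle T → A := fun t => x t - truncate (x t) with hr
  have hrc : Continuous r := hxc.sub hyc
  have hcoef : ∀ j ∈ J, e j = (2 : ℝ) • fourierCoeff r (φ j) := by
    intro j hj
    rw [he, ← fourierCoeff_trigSum_of_injOn (T := T) hφ.injOn d hj, hr, fourierCoeff, fourierCoeff,
      fourierCoeff, ← integral_sub]
    · simp_rw [smul_sub]
      rfl
    all_goals exact Continuous.integrable_haarAddCircle (by fun_prop)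
  have h1 : ∑ j ∈ J, star (e j) * e j =
      (4 : ℝ) • ∑ j ∈ J, star (fourierCoeff r (φ j)) * fourierCoeff r (φ j) := by
    rw [Finset.smul_sum]
    refine Finset.sum_congr rfl fun j hj => ?_
    rw [hcoef j hj, star_smul, smul_mul_smul_comm]
    norm_num
  have h2 := sum_star_fourierCoeff_mul_self_le hφ.injOn hrc
  have h3 : (8 : ℝ) • ∫ t, star (r t) * r t ∂haarAddCircle ≤ 2 := by
    refine le_trans ?_ (integral_sq_star_trigSum_mul_self_le (T := T) hφ hcol hrow)
    rw [← integral_smul]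
    refine integral_mono (Continuous.integrable_haarAddCircle (by fun_prop))
      (Continuous.integrable_haarAddCircle (by fun_prop)) fun t => ?_
    have := star_sub_truncate_mul_self_le (x t)
    rwa [← hx, Algebra.smul_def, map_ofNat]
  rw [h1]
  calc (4 : ℝ) • ∑ j ∈ J, star (fourierCoeff r (φ j)) * fourierCoeff r (φ j)
      ≤ (4 : ℝ) • ∫ t, star (r t) * r t ∂haarAddCircle := by gcongr
    _ = (1 / 2 : ℝ) • (8 : ℝ) • ∫ t, star (r t) * r t ∂haarAddCircle := by
        rw [smul_smul]; norm_num
    _ ≤ (1 / 2 : ℝ) • (2 : A) := by gcongr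
    _ = 1 := by
        rw [show (2 : A) = (2 : ℝ) • (1 : A) by rw [Algebra.smul_def, map_ofNat, mul_one], smul_smul]
        norm_num

/-- The column statement for the adjoint function, whose frequencies are `-φ j` and coefficients
`star (d j)`. -/
theorem sum_mul_star_self_sub_truncate_le {J : Finset ι} {φ : ι → ℤ}
    (hφ : DistinctDifferences J φ) {d : ι → A} (hcol : ∑ j ∈ J, star (d j) * d j ≤ 1)
    (hrow : ∑ j ∈ J, d j * star (d j) ≤ 1) {e : ι → A}
    (he : ∀ j, e j = (2 : ℝ) • (d j -
      fourierCoeff (fun t : AddCircle T => truncate (trigSum J φ d t)) (φ j))) :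
    ∑ j ∈ J, e j * star (e j) ≤ 1 := by
  have h := sum_star_mul_self_sub_truncate_le (T := T) hφ.neg (d := fun j => star (d j))
    (by simpa using hrow) (by simpa using hcol) (e := fun j => star (e j)) fun j => by
      rw [he, star_smul, star_sub, star_fourierCoeff]
      simp_rw [← truncate_star, star_trigSum]
      simp
  simpa using h

end TrigSum

/-! ### Arithmetic of strongly lacunary sequences. -/

theorem IsStronglyLacunary.strictMono {k : ℕ → ℕ} (hk : IsStronglyLacunary k) : StrictMono k :=
  strictMono_nat_of_lt_succ fun n => by have := hk n; omega

theorem IsStronglyLacunary.two_mul_lt {k : ℕ → ℕ} (hk : IsStronglyLacunary k) {i j : ℕ}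
    (hij : i < j) : 2 * k i < k j := by
  exact (hk i).trans_le (hk.strictMono.monotone hij)

theorem IsStronglyLacunary.injective {k : ℕ → ℕ} (hk : IsStronglyLacunary k) :
    Function.Injective k :=
  hk.strictMono.injective

/-- A nontrivial coincidence would read `k a + k d = k b + k c` with no index common to both sides.
The largest term exceeds twice each term opposite it, hence exceeds their sum. -/
theorem IsStronglyLacunary.distinctDifferences {k : ℕ → ℕ} (hk : IsStronglyLacunary k)
    (J : Finset ℕ) : DistinctDifferences J fun j => (k j : ℤ) := by
  intro a _ b _ c _ d _ hab h
  beta_reduce at h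
  have hinj : ∀ i j, (k i : ℤ) = k j → i = j := fun i j h => hk.injective (by exact_mod_cast h)
  have hsep : ∀ i j, i ≠ j → 2 * k i < k j ∨ 2 * k j < k i := fun i j hij =>
    hij.lt_or_gt.imp hk.two_mul_lt hk.two_mul_lt
  by_cases hac : a = c
  · subst hac
    exact ⟨rfl, hinj _ _ (by omega)⟩
  have hdb : d ≠ b := by
    rintro rfl
    exact hac (hinj _ _ (by omega))
  have hdc : d ≠ c := by
    rintro rfl
    exact hab (hinj _ _ (by omega))
  have h1 := hsep a b hab
  have h2 := hsep a c hac
  have h3 := hsep d b hdb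
  have h4 := hsep d c hdc
  omega

/-! ### The trace pairing of a contractive sequence with a trigonometric polynomial. -/

section Pairing

variable {H : Type*} [NormedAddCommGroup H] [InnerProductSpace ℂ H] [CompleteSpace H]

/-- The part of the trace that belongs to finitely many basis vectors. -/
noncomputable def traceOn (F : Finset (exists_hilbertBasis ℂ H).choose) : (H →L[ℂ] H) →L[ℂ] ℂ :=
  ∑ i ∈ F, (innerSL ℂ (onb H i)) ∘L (ContinuousLinearMap.apply ℂ H (onb H i))

theorem traceOn_apply (F : Finset (exists_hilbertBasis ℂ H).choose) (A : H →L[ℂ] H) :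
    traceOn F A = ∑ i ∈ F, ⟪onb H i, A (onb H i)⟫_ℂ := by
  simp [traceOn, sum_apply]

theorem re_traceOn_mul_le (F : Finset (exists_hilbertBasis ℂ H).choose) {V : H →L[ℂ] H}
    (hV : ‖V‖ ≤ 1) (A : SchattenOne H) : (traceOn F (V * SchattenOne.toCLM H A)).re ≤ ‖A‖ := by
  rw [traceOn_apply, Complex.re_sum, SchattenOne.norm_def,
    ← ENNReal.ofReal_le_iff_le_toReal A.traceENorm_ne_top]
  exact (traceENorm_le_iff _ _).1 le_rfl V hV F

variable {T : ℝ} [hT : Fact (0 < T)]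

/-- The inclusion of the Schatten class in the bounded operators, as a continuous map. -/
noncomputable def SchattenOne.toCLMContinuous : SchattenOne H →L[ℂ] (H →L[ℂ] H) :=
  (SchattenOne.toCLM H).mkContinuous 1 fun A => by simpa using SchattenOne.norm_toCLM_le A

/-- Parseval's identity for the trace pairing. The pairing is bilinear, without conjugation, so the
frequency `φ j` meets the coefficient at `-φ j`. -/
theorem traceOn_fourierCoeff_mul_sum (F : Finset (exists_hilbertBasis ℂ H).choose)
    {y : AddCircle T → H →L[ℂ] H} (hy : Continuous y) (J : Finset ℕ) (φ : ℕ → ℤ)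
    (c : ℕ → SchattenOne H) :
    ∑ j ∈ J, traceOn F (fourierCoeff y (-φ j) * SchattenOne.toCLM H (c j)) =
      ∫ t, traceOn F (y t * SchattenOne.toCLM H (trigSum J φ c t)) ∂haarAddCircle := by
  have h1 : ∀ t, traceOn F (y t * SchattenOne.toCLM H (trigSum J φ c t)) =
      ∑ j ∈ J, traceOn F ((fourier (φ j) t • y t) * SchattenOne.toCLM H (c j)) := fun t => by
    rw [trigSum, map_sum, Finset.mul_sum, map_sum]
    refine Finset.sum_congr rfl fun j _ => ?_
    rw [map_smul, mul_smul_comm, smul_mul_assoc]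
  simp_rw [h1]
  rw [integral_finsetSum _ fun j _ => Continuous.integrable_haarAddCircle (by fun_prop)]
  refine Finset.sum_congr rfl fun j _ => ?_
  rw [ContinuousLinearMap.integral_comp_comm _
    (Continuous.integrable_haarAddCircle (by fun_prop)), integral_mul_const_of_integrable
    (Continuous.integrable_haarAddCircle (by fun_prop)), fourierCoeff, neg_neg]

/-- One step of the iteration: the coefficients of the contraction `y` account for at most the `L¹`
norm, and what remains of `d` is half of an admissible sequence `e`. -/
theorem re_sum_traceOn_le_add {J : Finset ℕ} {φ : ℕ → ℤ} (hφ : DistinctDifferences J φ)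
    (F : Finset (exists_hilbertBasis ℂ H).choose) (c : ℕ → SchattenOne H) {d : ℕ → H →L[ℂ] H}
    (hcol : ∑ j ∈ J, star (d j) * d j ≤ 1) (hrow : ∑ j ∈ J, d j * star (d j) ≤ 1) :
    ∃ e : ℕ → H →L[ℂ] H, ∑ j ∈ J, star (e j) * e j ≤ 1 ∧ ∑ j ∈ J, e j * star (e j) ≤ 1 ∧
      (∑ j ∈ J, traceOn F (d j * SchattenOne.toCLM H (c j))).re ≤
        ∫ t : AddCircle T, ‖trigSum J φ c t‖ ∂haarAddCircle +
          (∑ j ∈ J, traceOn F (e j * SchattenOne.toCLM H (c j))).re / 2 := by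
  set y : AddCircle T → H →L[ℂ] H := fun t => truncate (trigSum J (fun j => -φ j) d t) with hy
  have hyc : Continuous y := continuous_truncate.comp (continuous_trigSum _ _ _)
  refine ⟨fun j => (2 : ℝ) • (d j - fourierCoeff y (-φ j)),
    sum_star_mul_self_sub_truncate_le hφ.neg hcol hrow fun j => rfl,
    sum_mul_star_self_sub_truncate_le hφ.neg hcol hrow fun j => rfl, ?_⟩
  have h1 : ∑ j ∈ J, traceOn F ((2 : ℝ) • (d j - fourierCoeff y (-φ j)) *
      SchattenOne.toCLM H (c j)) = (2 : ℝ) • (∑ j ∈ J, traceOn F (d j * SchattenOne.toCLM H (c j)) -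
        ∑ j ∈ J, traceOn F (fourierCoeff y (-φ j) * SchattenOne.toCLM H (c j))) := by
    rw [← Finset.sum_sub_distrib, Finset.smul_sum]
    refine Finset.sum_congr rfl fun j _ => ?_
    rw [smul_mul_assoc, sub_mul, ← map_sub]
    exact ((traceOn F).restrictScalars ℝ).map_smul _ _
  have h2 : (∫ t, traceOn F (y t * SchattenOne.toCLM H (trigSum J φ c t)) ∂haarAddCircle).re ≤
      ∫ t : AddCircle T, ‖trigSum J φ c t‖ ∂haarAddCircle := by
    have hcont : Continuous fun t : AddCircle T =>
        traceOn F (y t * SchattenOne.toCLM H (trigSum J φ c t)) :=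
      (traceOn F).continuous.comp
        (hyc.mul (SchattenOne.toCLMContinuous.continuous.comp (continuous_trigSum J φ c)))
    have h3 := Complex.reCLM.integral_comp_comm hcont.integrable_haarAddCircle
    simp only [Complex.reCLM_apply] at h3
    rw [← h3]
    refine integral_mono (Continuous.integrable_haarAddCircle (by fun_prop))
      (Continuous.integrable_haarAddCircle (by fun_prop)) fun t => ?_
    exact re_traceOn_mul_le F (norm_truncate_le _) _
  rw [← traceOn_fourierCoeff_mul_sum F hyc] at h2
  rw [h1, Complex.smul_re, Complex.sub_re, smul_eq_mul]
  linarith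

theorem re_sum_traceOn_le {J : Finset ℕ} {φ : ℕ → ℤ} (hφ : DistinctDifferences J φ)
    (F : Finset (exists_hilbertBasis ℂ H).choose) (c : ℕ → SchattenOne H) {d : ℕ → H →L[ℂ] H}
    (hcol : ∑ j ∈ J, star (d j) * d j ≤ 1) (hrow : ∑ j ∈ J, d j * star (d j) ≤ 1) :
    (∑ j ∈ J, traceOn F (d j * SchattenOne.toCLM H (c j))).re ≤
      2 * ∫ t : AddCircle T, ‖trigSum J φ c t‖ ∂haarAddCircle := by
  set I := ∫ t : AddCircle T, ‖trigSum J φ c t‖ ∂haarAddCircle with hI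
  have hI0 : 0 ≤ I := integral_nonneg fun t => norm_nonneg _
  -- The bound starts from the crude estimate `∑ ‖c j‖`, valid since each `d j` is a contraction.
  -- Each step halves this term and preserves `2 I`, as `I + (2 I) / 2 = 2 I`.
  have key : ∀ n : ℕ, ∀ d : ℕ → H →L[ℂ] H, ∑ j ∈ J, star (d j) * d j ≤ 1 →
      ∑ j ∈ J, d j * star (d j) ≤ 1 →
      (∑ j ∈ J, traceOn F (d j * SchattenOne.toCLM H (c j))).re ≤
        2 * I + (∑ j ∈ J, ‖c j‖) * (1 / 2) ^ n := by
    intro n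
    induction n with
    | zero =>
      intro d hd _
      have h1 : (∑ j ∈ J, traceOn F (d j * SchattenOne.toCLM H (c j))).re ≤ ∑ j ∈ J, ‖c j‖ := by
        rw [Complex.re_sum]
        refine Finset.sum_le_sum fun j hj => re_traceOn_mul_le F ?_ _
        refine (d j).opNorm_le_bound zero_le_one fun u => ?_
        have h2 := (sum_star_mul_self_le_one_iff J d).1 hd u
        have h3 := Finset.single_le_sum (f := fun j => ‖d j u‖ ^ 2)
          (fun _ _ => by positivity) hj
        rw [one_mul]
        exact (abs_le_of_sq_le_sq' (h3.trans h2) (norm_nonneg _)).2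
      simpa using h1.trans (by linarith)
    | succ n ih =>
      intro d hd hd'
      obtain ⟨e, he, he', h⟩ := re_sum_traceOn_le_add (T := T) hφ F c hd hd'
      have := ih e he he'
      rw [pow_succ]
      linarith
  have hlim : Filter.Tendsto (fun n : ℕ => 2 * I + (∑ j ∈ J, ‖c j‖) * (1 / 2 : ℝ) ^ n) Filter.atTop
      (nhds (2 * I + (∑ j ∈ J, ‖c j‖) * 0)) :=
    ((tendsto_pow_atTop_nhds_zero_of_lt_one (by norm_num) (by norm_num)).const_mul _).const_add _
  rw [mul_zero, add_zero] at hlim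
  exact ge_of_tendsto' hlim fun n => key n d hcol hrow

end Pairing

/-! ### Dual description of the splitting norm on finite sequences. -/

section Duality

variable {H : Type*} [NormedAddCommGroup H] [InnerProductSpace ℂ H] [CompleteSpace H]

theorem eq_sum_rankOne_of_apply_eq_zero (F : Finset (exists_hilbertBasis ℂ H).choose)
    {A : H →L[ℂ] H} (hA : ∀ i ∉ F, A (onb H i) = 0) :
    A = ∑ i ∈ F, InnerProductSpace.rankOne ℂ (A (onb H i)) (onb H i) := by
  classical
  refine ContinuousLinearMap.ext_on
    (Submodule.dense_iff_topologicalClosure_eq_top.2 (onb H).dense_span) ?_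
  rintro _ ⟨j, rfl⟩
  have hon := orthonormal_iff_ite.1 (onb H).orthonormal
  simp only [sum_apply, InnerProductSpace.rankOne_apply, hon, ite_smul, one_smul, zero_smul,
    Finset.sum_ite_eq']
  split_ifs with hj
  · rfl
  · exact hA j hj

namespace SchattenOne

/-- The operator `⟪u, ·⟫ x` as an element of the Schatten class. -/
noncomputable def rankOne (x u : H) : SchattenOne H :=
  (⟨InnerProductSpace.rankOne ℂ x u, by
    exact (isCompactOperator_of_locallyCompactSpace_dom (innerSL ℂ u)).clm_comp
      (ContinuousLinearMap.toSpanSingleton ℂ x), (traceENorm_rankOne_le x u).trans_lt (by finiteness)⟩ :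
      schattenOneSubmodule H)

theorem toCLM_rankOne (x u : H) : toCLM H (rankOne x u) = InnerProductSpace.rankOne ℂ x u := rfl

theorem rankOne_zero_left (u : H) : rankOne 0 u = 0 :=
  toCLM_injective (by simp [toCLM_rankOne])

end SchattenOne

/-- A finitely supported sequence in the Schatten class, as a sequence of bounded operators. -/
noncomputable def operatorSeq (c : ℕ →₀ SchattenOne H) (j : ℕ) : H →L[ℂ] H :=
  SchattenOne.toCLM H (c j)

theorem splittingNorm_operatorSeq_single_le (j : ℕ) (A : SchattenOne H) :
    splittingNorm (operatorSeq (Finsupp.single j A)) ≤ traceENorm (SchattenOne.toCLM H A) := by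
  refine (splittingNorm_le_columnNorm fun i => SchattenOne.isCompactOperator _).trans ?_
  refine (le_of_eq ?_).trans (columnNorm_single_le j (SchattenOne.toCLM H A))
  congr 1
  funext i
  by_cases h : i = j
  · subst h
    simp
  · simp [h]

theorem splittingNorm_operatorSeq_ne_top (c : ℕ →₀ SchattenOne H) :
    splittingNorm (operatorSeq c) ≠ ⊤ := by
  induction c using Finsupp.induction_linear with
  | zero =>
    have : operatorSeq (0 : ℕ →₀ SchattenOne H) = fun _ => 0 := by funext j; simp [operatorSeq]
    simp [this, splittingNorm_zero]
  | add c d hc hd =>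
    refine ne_top_of_le_ne_top (ENNReal.add_ne_top.2 ⟨hc, hd⟩) ?_
    refine (le_of_eq ?_).trans (splittingNorm_add_le _ _)
    congr 1
  | single j A =>
    exact ne_top_of_le_ne_top A.traceENorm_ne_top (splittingNorm_operatorSeq_single_le j A)

variable (H) in
/-- The splitting norm as a seminorm on the finitely supported sequences. -/
noncomputable def splittingSeminorm : Seminorm ℂ (ℕ →₀ SchattenOne H) :=
  Seminorm.ofSMulLE (fun c => (splittingNorm (operatorSeq c)).toReal)
    (by
      have : operatorSeq (0 : ℕ →₀ SchattenOne H) = fun _ => 0 := by funext j; simp [operatorSeq]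
      simp [this, splittingNorm_zero])
    (fun c d => by
      rw [← ENNReal.toReal_add (splittingNorm_operatorSeq_ne_top c)
        (splittingNorm_operatorSeq_ne_top d)]
      refine ENNReal.toReal_mono (ENNReal.add_ne_top.2 ⟨splittingNorm_operatorSeq_ne_top c,
        splittingNorm_operatorSeq_ne_top d⟩) ?_
      refine (le_of_eq ?_).trans (splittingNorm_add_le _ _)
      congr 1)
    (fun z c => by
      rw [← toReal_enorm, ← ENNReal.toReal_mul]
      refine ENNReal.toReal_mono (ENNReal.mul_ne_top (by finiteness)
        (splittingNorm_operatorSeq_ne_top c)) ?_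
      refine (le_of_eq ?_).trans (splittingNorm_smul_le z _)
      congr 1)

theorem splittingSeminorm_apply (c : ℕ →₀ SchattenOne H) :
    splittingSeminorm H c = (splittingNorm (operatorSeq c)).toReal := rfl

/-- Hahn–Banach, extending `z • x ↦ z p(x)` from the line through `x`. -/
theorem Seminorm.exists_dual_vector {E : Type*} [AddCommGroup E] [Module ℂ E] (p : Seminorm ℂ E)
    (x : E) : ∃ g : E →ₗ[ℂ] ℂ, g x = p x ∧ ∀ y, ‖g y‖ ≤ p y := by
  by_cases hx : x = 0
  · exact ⟨0, by simp [hx], fun y => by simp⟩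
  let f : Submodule.span ℂ {x} →ₗ[ℂ] ℂ :=
    (p x : ℂ) • (LinearEquiv.coord ℂ E x hx : Submodule.span ℂ {x} →ₗ[ℂ] ℂ)
  obtain ⟨g, hg, hgp⟩ := Module.Dual.exists_extension_of_le_seminorm (Submodule.span ℂ {x}) f
    (p := p) fun y => by
      conv_rhs => rw [← LinearEquiv.coord_apply_smul ℂ E x hx y, map_smul_eq_mul]
      simp [f, mul_comm, abs_of_nonneg (apply_nonneg p x)]
  refine ⟨g, ?_, hgp⟩
  have := hg ⟨x, Submodule.mem_span_singleton_self x⟩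
  rw [this]
  simp [f, LinearEquiv.coord_self]

/-- A functional bounded by the splitting norm is represented, on operators of rank one, by
bounded operators. -/
theorem exists_operator_of_le_splittingSeminorm {g : (ℕ →₀ SchattenOne H) →ₗ[ℂ] ℂ}
    (hg : ∀ c, ‖g c‖ ≤ splittingSeminorm H c) :
    ∃ d : ℕ → H →L[ℂ] H, ∀ j x u,
      g (Finsupp.single j (SchattenOne.rankOne x u)) = ⟪u, d j x⟫_ℂ := by
  have hadd : ∀ x x' u : H, SchattenOne.rankOne (x + x') u =
      SchattenOne.rankOne x u + SchattenOne.rankOne x' u := fun x x' u =>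
    SchattenOne.toCLM_injective (by simp [SchattenOne.toCLM_rankOne])
  have hadd' : ∀ x u u' : H, SchattenOne.rankOne x (u + u') =
      SchattenOne.rankOne x u + SchattenOne.rankOne x u' := fun x u u' =>
    SchattenOne.toCLM_injective (by simp [SchattenOne.toCLM_rankOne])
  have hsmul : ∀ (z : ℂ) (x u : H), SchattenOne.rankOne (z • x) u =
      z • SchattenOne.rankOne x u := fun z x u =>
    SchattenOne.toCLM_injective (by simp [SchattenOne.toCLM_rankOne])
  have hsmul' : ∀ (z : ℂ) (x u : H), SchattenOne.rankOne x (z • u) =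
      star z • SchattenOne.rankOne x u := fun z x u =>
    SchattenOne.toCLM_injective (by simp [SchattenOne.toCLM_rankOne])
  let B : ℕ → H →ₗ⋆[ℂ] H →ₗ[ℂ] ℂ := fun j =>
    LinearMap.mk₂'ₛₗ (starRingEnd ℂ) (RingHom.id ℂ)
      (fun u x => g (Finsupp.single j (SchattenOne.rankOne x u)))
      (fun u u' x => by rw [hadd', Finsupp.single_add, map_add])
      (fun z u x => by rw [hsmul', ← Finsupp.smul_single, map_smul]; rfl)
      (fun u x x' => by rw [hadd, Finsupp.single_add, map_add])
      (fun z u x => by rw [hsmul, ← Finsupp.smul_single, map_smul]; rfl)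
  have hB : ∀ j u x, ‖B j u x‖ ≤ 1 * ‖u‖ * ‖x‖ := by
    intro j u x
    refine (hg _).trans ?_
    rw [splittingSeminorm_apply, one_mul, mul_comm]
    refine ENNReal.toReal_le_of_le_ofReal (by positivity) ?_
    refine (splittingNorm_operatorSeq_single_le j _).trans ?_
    rw [SchattenOne.toCLM_rankOne, ENNReal.ofReal_mul (norm_nonneg _), ofReal_norm, ofReal_norm]
    exact traceENorm_rankOne_le x u
  refine ⟨fun j => star (InnerProductSpace.continuousLinearMapOfBilin
    ((B j).mkContinuous₂ 1 (hB j))), fun j x u => ?_⟩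
  beta_reduce
  rw [ContinuousLinearMap.star_eq_adjoint, ContinuousLinearMap.adjoint_inner_right,
    InnerProductSpace.continuousLinearMapOfBilin_apply]
  rfl

theorem le_sq_of_le_sqrt_mul {s r : ℝ} (hs : 0 ≤ s) (h : s ≤ √s * r) :
    s ≤ r ^ 2 := by
  have h1 := Real.sq_sqrt hs
  have h2 := Real.sqrt_nonneg s
  by_contra! h3
  have h4 : r < √s := Real.lt_sqrt_of_sq_lt h3
  nlinarith

/-- The functional is tested on rank-one sequences for which it returns `∑ ‖d_j u‖²` or `∑ ‖d_j*
u‖²`, while their splitting norm is at most the square root of that sum times `‖u‖`. The trivial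
splittings `0 + c` and `c + 0` give the column and the row bound. -/
theorem operator_contractive_of_le_splittingSeminorm {g : (ℕ →₀ SchattenOne H) →ₗ[ℂ] ℂ}
    (hg : ∀ c, ‖g c‖ ≤ splittingSeminorm H c) {d : ℕ → H →L[ℂ] H}
    (hd : ∀ j x u, g (Finsupp.single j (SchattenOne.rankOne x u)) = ⟪u, d j x⟫_ℂ)
    (J : Finset ℕ) :
    ∑ j ∈ J, star (d j) * d j ≤ 1 ∧ ∑ j ∈ J, d j * star (d j) ≤ 1 := by
  classical
  have hseq : ∀ c : ℕ → SchattenOne H, operatorSeq (∑ j ∈ J, Finsupp.single j (c j)) =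
      fun j => if j ∈ J then SchattenOne.toCLM H (c j) else 0 := by
    intro c
    funext j
    by_cases hj : j ∈ J <;> simp [operatorSeq, Finsupp.finsetSum_apply, Finsupp.single_apply, hj]
  have hgsum : ∀ c : ℕ → SchattenOne H, ‖∑ j ∈ J, g (Finsupp.single j (c j))‖ ≤
      (splittingNorm fun j => if j ∈ J then SchattenOne.toCLM H (c j) else 0).toReal := by
    intro c
    rw [← map_sum, ← hseq]
    exact hg _
  have hcol : ∀ (x : ℕ → H) (u : H), columnNorm (fun j => if j ∈ J then
      InnerProductSpace.rankOne ℂ (x j) u else 0) ≤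
        ENNReal.ofReal (√(∑ j ∈ J, ‖x j‖ ^ 2) * ‖u‖) := by
    intro x u
    have h := columnNorm_rankOne_le J (fun j => if j ∈ J then x j else 0)
      (fun j hj => if_neg hj) u
    have e1 : ∑ j ∈ J, ‖if j ∈ J then x j else 0‖ ^ 2 = ∑ j ∈ J, ‖x j‖ ^ 2 :=
      Finset.sum_congr rfl fun j hj => by rw [if_pos hj]
    rw [e1] at h
    refine (le_of_eq ?_).trans h
    congr 1
    funext j
    split_ifs <;> simp
  have hcpt : ∀ c : ℕ → SchattenOne H, ∀ j,
      IsCompactOperator (if j ∈ J then SchattenOne.toCLM H (c j) else 0 : H →L[ℂ] H) := by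
    intro c j
    split_ifs
    · exact SchattenOne.isCompactOperator _
    · exact isCompactOperator_zero
  constructor
  · rw [sum_star_mul_self_le_one_iff]
    intro u
    refine le_sq_of_le_sqrt_mul (by positivity) ?_
    have h := hgsum fun j => SchattenOne.rankOne u (d j u)
    simp only [hd, inner_self_eq_norm_sq_to_K, SchattenOne.toCLM_rankOne] at h
    have e : ‖∑ j ∈ J, ((‖d j u‖ : ℂ)) ^ 2‖ = ∑ j ∈ J, ‖d j u‖ ^ 2 := by
      rw [← Complex.norm_of_nonneg (r := ∑ j ∈ J, ‖d j u‖ ^ 2) (by positivity)]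
      push_cast
      rfl
    refine (e.symm.le.trans h).trans ?_
    refine ENNReal.toReal_le_of_le_ofReal (by positivity) ?_
    refine (splittingNorm_le_columnNorm_star (hcpt fun j => SchattenOne.rankOne u (d j u))).trans ?_
    refine (le_of_eq ?_).trans (hcol (fun j => d j u) u)
    congr 1
    funext j
    split_ifs
    · rw [SchattenOne.toCLM_rankOne, ContinuousLinearMap.star_eq_adjoint,
        InnerProductSpace.adjoint_rankOne]
    · simp
  · have hiff := sum_star_mul_self_le_one_iff J fun j => star (d j)
    simp only [star_star] at hiff
    rw [hiff]
    intro u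
    refine le_sq_of_le_sqrt_mul (by positivity) ?_
    have h := hgsum fun j => SchattenOne.rankOne (star (d j) u) u
    simp only [hd, SchattenOne.toCLM_rankOne] at h
    have e : ‖∑ j ∈ J, ⟪u, d j (star (d j) u)⟫_ℂ‖ = ∑ j ∈ J, ‖star (d j) u‖ ^ 2 := by
      rw [← Complex.norm_of_nonneg (r := ∑ j ∈ J, ‖star (d j) u‖ ^ 2) (by positivity)]
      push_cast
      congr 1
      refine Finset.sum_congr rfl fun j _ => ?_
      rw [← ContinuousLinearMap.adjoint_inner_left, ← ContinuousLinearMap.star_eq_adjoint,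
        inner_self_eq_norm_sq_to_K]
      rfl
    refine (e.symm.le.trans h).trans ?_
    refine ENNReal.toReal_le_of_le_ofReal (by positivity) ?_
    refine (splittingNorm_le_columnNorm
      (hcpt fun j => SchattenOne.rankOne (star (d j) u) u)).trans ?_
    exact hcol (fun j => star (d j) u) u

/-- The inequality for trigonometric polynomials whose coefficients vanish on almost all
basis vectors. -/
theorem splittingNorm_operatorSeq_le {T : ℝ} [Fact (0 < T)] {k : ℕ → ℕ}
    (hk : IsStronglyLacunary k) (c : ℕ →₀ SchattenOne H)
    (F : Finset (exists_hilbertBasis ℂ H).choose)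
    (hF : ∀ j, ∀ i ∉ F, SchattenOne.toCLM H (c j) (onb H i) = 0) :
    splittingNorm (operatorSeq c) ≤ ENNReal.ofReal (2 *
      ∫ t : AddCircle T, ‖trigSum c.support (fun j => (k j : ℤ)) c t‖ ∂haarAddCircle) := by
  obtain ⟨g, hgc, hg⟩ := (splittingSeminorm H).exists_dual_vector c
  obtain ⟨d, hd⟩ := exists_operator_of_le_splittingSeminorm hg
  obtain ⟨hcol, hrow⟩ := operator_contractive_of_le_splittingSeminorm hg hd c.support
  have h := re_sum_traceOn_le (T := T) (hk.distinctDifferences c.support) F c hcol hrow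
  have e : g c = ∑ j ∈ c.support, traceOn F (d j * SchattenOne.toCLM H (c j)) := by
    conv_lhs => rw [← Finsupp.sum_single c, Finsupp.sum, map_sum]
    refine Finset.sum_congr rfl fun j _ => ?_
    -- `g` is known explicitly only on operators of rank one; finiteness of `F` makes each
    -- coefficient a finite sum of these.
    have e1 : c j = ∑ i ∈ F, SchattenOne.rankOne (SchattenOne.toCLM H (c j) (onb H i))
        (onb H i) := by
      apply SchattenOne.toCLM_injective
      rw [map_sum]
      exact eq_sum_rankOne_of_apply_eq_zero F (hF j)
    conv_lhs => rw [e1]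
    rw [← Finsupp.singleAddHom_apply, map_sum, map_sum, traceOn_apply]
    exact Finset.sum_congr rfl fun i _ => hd _ _ _
  rw [← e, hgc, Complex.ofReal_re, splittingSeminorm_apply] at h
  rw [← ENNReal.ofReal_toReal (splittingNorm_operatorSeq_ne_top c)]
  exact ENNReal.ofReal_le_ofReal h

end Duality

/-! ### Density of the operators of finite rank -/

section FiniteRank

variable {H : Type*} [NormedAddCommGroup H] [InnerProductSpace ℂ H] [CompleteSpace H]

/-- Cauchy–Schwarz after an approximate polar decomposition. One factor is bounded by the full
trace, the other sees only the basis vectors in `G`, so the estimate becomes small when `G` lies in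
a tail. -/
theorem sum_re_inner_mul_le_sqrt (A : SchattenOne H) {V : H →L[ℂ] H} (hV : ‖V‖ ≤ 1)
    (G : Finset (exists_hilbertBasis ℂ H).choose) :
    ∑ i ∈ G, (⟪onb H i, (V * SchattenOne.toCLM H A) (onb H i)⟫_ℂ).re ≤
      √‖A‖ * √(∑ i ∈ G, ‖CFC.sqrt (CFC.abs (SchattenOne.toCLM H A)) (onb H i)‖ ^ 2) := by
  set B := SchattenOne.toCLM H A with hB
  set P := CFC.abs B with hP
  set R := CFC.sqrt P with hR
  have hP0 : 0 ≤ P := CFC.abs_nonneg B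
  have hRsa : star R = R := (CFC.sqrt_nonneg P).isSelfAdjoint.star_eq
  have hRR : R * R = P := CFC.sqrt_mul_sqrt_self P hP0
  have hW : ∀ W : H →L[ℂ] H, ‖W‖ ≤ 1 → ∑ i ∈ G, (⟪onb H i, (W * P) (onb H i)⟫_ℂ).re ≤
      √‖A‖ * √(∑ i ∈ G, ‖R (onb H i)‖ ^ 2) := by
    intro W hW
    have key : ∀ i ∈ G, (⟪onb H i, (W * P) (onb H i)⟫_ℂ).re ≤
        ‖(star (W * R)) (onb H i)‖ * ‖R (onb H i)‖ := by
      intro i _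
      have e : ⟪onb H i, (W * P) (onb H i)⟫_ℂ = ⟪(star (W * R)) (onb H i), R (onb H i)⟫_ℂ := by
        rw [ContinuousLinearMap.star_eq_adjoint, ContinuousLinearMap.adjoint_inner_left, ← hRR,
          ← mul_assoc, mul_apply_eq_comp]
      rw [e]
      exact (Complex.re_le_norm _).trans (norm_inner_le_norm _ _)
    have b1 : ∑ i ∈ G, ‖(star (W * R)) (onb H i)‖ ^ 2 ≤ ‖A‖ := by
      rw [SchattenOne.norm_def, ← ENNReal.ofReal_le_iff_le_toReal A.traceENorm_ne_top,
        ENNReal.ofReal_sum_of_nonneg (by intros; positivity)]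
      simp_rw [ENNReal.ofReal_pow (norm_nonneg _), ofReal_norm]
      rw [traceENorm, opTrace_eq_sqrt hP0]
      exact (ENNReal.sum_le_tsum G).trans (tsum_enorm_star_mul_le W R hW)
    refine (Finset.sum_le_sum key).trans ((Real.sum_mul_le_sqrt_mul_sqrt _ _ _).trans ?_)
    gcongr
  refine le_of_forall_pos_le_add fun δ hδ => ?_
  obtain ⟨U, hU, h1, -⟩ := exists_polar_approx B (ε := δ / (G.card + 1)) (by positivity)
  refine (sum_inner_le_add (V * B) (V * U * P) G).trans (add_le_add
    (hW (V * U) ((norm_mul_le V U).trans (mul_le_one₀ hV (norm_nonneg _) hU))) ?_)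
  have h2 : ‖V * B - V * U * P‖ ≤ δ / (G.card + 1) := by
    calc ‖V * B - V * U * P‖ = ‖V * (B - U * P)‖ := by rw [mul_sub, mul_assoc]
      _ ≤ ‖V‖ * ‖B - U * P‖ := norm_mul_le _ _
      _ ≤ 1 * (δ / (G.card + 1)) := by gcongr
      _ = _ := one_mul _
  calc (G.card : ℝ) * ‖V * B - V * U * P‖ ≤ G.card * (δ / (G.card + 1)) := by gcongr
    _ ≤ δ := by
      rw [mul_div_assoc', div_le_iff₀ (by positivity)]
      nlinarith

/-- The compression of an element of the Schatten class to finitely many basis vectors. -/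
noncomputable def SchattenOne.truncateBasis (A : SchattenOne H)
    (F : Finset (exists_hilbertBasis ℂ H).choose) : SchattenOne H :=
  ∑ i ∈ F, SchattenOne.rankOne (SchattenOne.toCLM H A (onb H i)) (onb H i)

open Classical in
theorem SchattenOne.toCLM_truncateBasis_apply (A : SchattenOne H)
    (F : Finset (exists_hilbertBasis ℂ H).choose) (i : (exists_hilbertBasis ℂ H).choose) :
    SchattenOne.toCLM H (A.truncateBasis F) (onb H i) =
      if i ∈ F then SchattenOne.toCLM H A (onb H i) else 0 := by
  have hon := orthonormal_iff_ite.1 (onb H).orthonormal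
  simp only [SchattenOne.truncateBasis, map_sum, SchattenOne.toCLM_rankOne, sum_apply,
    InnerProductSpace.rankOne_apply, hon, ite_smul, one_smul, zero_smul, Finset.sum_ite_eq']

theorem SchattenOne.exists_norm_sub_truncateBasis_le (A : SchattenOne H) {ε : ℝ} (hε : 0 < ε) :
    ∃ F₀ : Finset (exists_hilbertBasis ℂ H).choose, ∀ F, F₀ ⊆ F → ‖A - A.truncateBasis F‖ ≤ ε := by
  classical
  set B := SchattenOne.toCLM H A with hB
  set R := CFC.sqrt (CFC.abs B) with hR
  have hsum : Summable fun i => ‖R (onb H i)‖ ^ 2 := by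
    have h1 : ∑' i, ‖R (onb H i)‖ₑ ^ 2 ≠ ⊤ := by
      rw [← opTrace_eq_sqrt (CFC.abs_nonneg B)]
      exact A.traceENorm_ne_top
    simpa using ENNReal.summable_toReal h1
  obtain ⟨F₀, hF₀⟩ := summable_iff_vanishing_norm.1 hsum (ε ^ 2 / (‖A‖ + 1)) (by positivity)
  refine ⟨F₀, fun F hF => ?_⟩
  rw [SchattenOne.norm_def]
  refine ENNReal.toReal_le_of_le_ofReal hε.le ((traceENorm_le_iff _ _).2 fun V hV F' => ?_)
  refine ENNReal.ofReal_le_ofReal ?_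
  -- The difference vanishes on the basis vectors in `F` and agrees with `B` on the others, so only
  -- the tail `F' \ F` contributes.
  have e : ∑ i ∈ F', (⟪onb H i, (V * SchattenOne.toCLM H (A - A.truncateBasis F))
      (onb H i)⟫_ℂ).re = ∑ i ∈ F' \ F, (⟪onb H i, (V * B) (onb H i)⟫_ℂ).re := by
    rw [← Finset.filter_notMem_eq_sdiff, Finset.sum_filter]
    refine Finset.sum_congr rfl fun i _ => ?_
    rw [mul_apply_eq_comp, map_sub, sub_apply, SchattenOne.toCLM_truncateBasis_apply]
    by_cases h : i ∈ F
    · simp [h]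
    · simp [h, hB, mul_apply_eq_comp]
  rw [e]
  refine (sum_re_inner_mul_le_sqrt A hV _).trans ?_
  have h1 := hF₀ (F' \ F) (Finset.sdiff_disjoint.mono_right hF)
  rw [Real.norm_of_nonneg (Finset.sum_nonneg fun _ _ => by positivity),
    lt_div_iff₀ (by positivity)] at h1
  rw [← Real.sqrt_mul (norm_nonneg _)]
  refine Real.sqrt_le_iff.2 ⟨hε.le, ?_⟩
  have h2 : 0 ≤ ∑ i ∈ F' \ F, ‖R (onb H i)‖ ^ 2 := Finset.sum_nonneg fun _ _ => by positivity
  nlinarith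

end FiniteRank

/-! ### Fejér means of vector-valued functions -/

section Fejer

variable {T : ℝ} [hT : Fact (0 < T)] {E : Type*} [NormedAddCommGroup E] [NormedSpace ℂ E]

variable (T E) in
/-- The monomial `e^{int} v`, as an element of `L¹`. -/
noncomputable def monomialLp (n : ℤ) : E →ₗ[ℂ] Lp E 1 (haarAddCircle (T := T)) where
  toFun v := ContinuousMap.toLp 1 haarAddCircle ℂ
    (⟨fun t => fourier n t • v, by fun_prop⟩ : C(AddCircle T, E))
  map_add' v w := by
    rw [← map_add]
    congr 1
    ext t
    exact smul_add _ _ _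
  map_smul' z v := by
    rw [RingHom.id_apply, ← map_smul]
    congr 1
    ext t
    exact smul_comm _ _ _

theorem coeFn_sum_monomialLp {ι : Type*} (J : Finset ι) (φ : ι → ℤ) (d : ι → E) :
    (∑ j ∈ J, monomialLp T E (φ j) (d j) : Lp E 1 (haarAddCircle (T := T))) =ᵐ[haarAddCircle]
      trigSum J φ d := by
  have e : (∑ j ∈ J, monomialLp T E (φ j) (d j) : Lp E 1 (haarAddCircle (T := T))) =
      ContinuousMap.toLp 1 haarAddCircle ℂ
        (⟨trigSum J φ d, continuous_trigSum J φ d⟩ : C(AddCircle T, E)) := by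
    simp only [monomialLp, LinearMap.coe_mk, AddHom.coe_mk]
    rw [← map_sum]
    congr 1
    ext t
    simp [trigSum]
  rw [e]
  exact ContinuousMap.coeFn_toLp haarAddCircle _

theorem norm_sum_monomialLp {ι : Type*} (J : Finset ι) (φ : ι → ℤ) (d : ι → E) :
    ‖(∑ j ∈ J, monomialLp T E (φ j) (d j))‖ =
      ∫ t : AddCircle T, ‖trigSum J φ d t‖ ∂haarAddCircle := by
  rw [L1.norm_eq_integral_norm]
  exact integral_congr_ae ((coeFn_sum_monomialLp J φ d).fun_comp norm)

theorem norm_fourierCoeff_le (f : Lp E 1 (haarAddCircle (T := T))) (n : ℤ) :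
    ‖fourierCoeff f n‖ ≤ ‖f‖ := by
  rw [L1.norm_eq_integral_norm, fourierCoeff]
  refine (norm_integral_le_integral_norm _).trans (le_of_eq ?_)
  refine integral_congr_ae (.of_forall fun t => ?_)
  simp [norm_smul, fourier_apply, Circle.norm_coe]

variable (T E) in
/-- The `n`-th Fourier coefficient as a continuous linear map on `L¹`. -/
noncomputable def fourierCoeffCLM (n : ℤ) : Lp E 1 (haarAddCircle (T := T)) →L[ℂ] E :=
  LinearMap.mkContinuous
    { toFun f := fourierCoeff f n
      map_add' f g := by
        rw [fourierCoeff_congr_ae (Lp.coeFn_add f g)]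
        exact congrFun (fourierCoeff.add (L1.integrable_coeFn f) (L1.integrable_coeFn g)) n
      map_smul' z f := by
        rw [fourierCoeff_congr_ae (Lp.coeFn_smul z f), fourierCoeff.const_smul]
        rfl } 1 fun f => by simpa using norm_fourierCoeff_le f n

theorem fourierCoeffCLM_apply (n : ℤ) (f : Lp E 1 (haarAddCircle (T := T))) :
    fourierCoeffCLM T E n f = fourierCoeff f n := rfl

theorem fourierCoeffCLM_sum_monomialLp [CompleteSpace E] {ι : Type*} (J : Finset ι) (φ : ι → ℤ)
    (d : ι → E) (n : ℤ) : fourierCoeffCLM T E n (∑ j ∈ J, monomialLp T E (φ j) (d j)) =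
      ∑ j ∈ J, if φ j = n then d j else 0 := by
  rw [fourierCoeffCLM_apply, fourierCoeff_congr_ae (coeFn_sum_monomialLp J φ d),
    fourierCoeff_trigSum]

variable (T E) in
/-- The Fejér mean of order `M`. -/
noncomputable def fejerMean (M : ℕ) :
    Lp E 1 (haarAddCircle (T := T)) →ₗ[ℂ] Lp E 1 (haarAddCircle (T := T)) :=
  (M : ℂ)⁻¹ • ∑ p ∈ Finset.range M ×ˢ Finset.range M,
    monomialLp T E ((p.1 : ℤ) - p.2) ∘ₗ (fourierCoeffCLM T E ((p.1 : ℤ) - p.2)).toLinearMap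

theorem fejerMean_apply (M : ℕ) (f : Lp E 1 (haarAddCircle (T := T))) :
    fejerMean T E M f = (M : ℂ)⁻¹ • ∑ p ∈ Finset.range M ×ˢ Finset.range M,
      monomialLp T E ((p.1 : ℤ) - p.2) (fourierCoeff f ((p.1 : ℤ) - p.2)) := by
  simp [fejerMean, fourierCoeffCLM_apply]

/-- The Fejér kernel. -/
noncomputable def fejerKernel (M : ℕ) (t : AddCircle T) : ℂ :=
  (M : ℂ)⁻¹ * ∑ p ∈ Finset.range M ×ˢ Finset.range M, fourier ((p.1 : ℤ) - p.2) t

omit hT in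
theorem continuous_fejerKernel (M : ℕ) : Continuous (fejerKernel M : AddCircle T → ℂ) := by
  unfold fejerKernel
  fun_prop

omit hT in
theorem fejerKernel_eq (M : ℕ) (t : AddCircle T) :
    fejerKernel M t = ((M : ℝ)⁻¹ * ‖∑ m ∈ Finset.range M, fourier (m : ℤ) t‖ ^ 2 : ℝ) := by
  rw [fejerKernel, Finset.sum_product]
  push_cast
  rw [← Complex.mul_conj', map_sum, Finset.sum_mul_sum]
  simp_rw [← fourier_neg, ← fourier_add, sub_eq_add_neg]

/-- The kernel is `M⁻¹` times a squared modulus, hence nonnegative; its `L¹` norm is its constant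
Fourier coefficient, to which only the `M` diagonal pairs contribute. For `M = 0` the kernel is
zero. -/
theorem lintegral_enorm_fejerKernel_le (M : ℕ) :
    ∫⁻ t : AddCircle T, ‖fejerKernel M t‖ₑ ∂haarAddCircle ≤ 1 := by
  have h1 : ∫ t : AddCircle T, ‖fejerKernel M t‖ ∂haarAddCircle ≤ 1 := by
    have h2 : ∀ t : AddCircle T, ‖fejerKernel M t‖ = (fejerKernel M t).re := fun t => by
      rw [fejerKernel_eq, Complex.norm_of_nonneg (by positivity), Complex.ofReal_re]
    have h3 := Complex.reCLM.integral_comp_comm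
      (continuous_fejerKernel (T := T) M).integrable_haarAddCircle
    simp only [Complex.reCLM_apply] at h3
    simp_rw [h2]
    rw [h3]
    simp_rw [fejerKernel]
    rw [integral_const_mul, integral_finsetSum _ fun p _ =>
      Continuous.integrable_haarAddCircle (by fun_prop), Finset.sum_product]
    simp_rw [integral_fourier, sub_eq_zero, Nat.cast_inj]
    have h4 : ∑ x ∈ Finset.range M, ∑ y ∈ Finset.range M, (if x = y then (1 : ℂ) else 0) = M := by
      rw [Finset.sum_congr rfl fun x hx => by rw [Finset.sum_ite_eq, if_pos hx]]
      simp
    rw [h4]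
    by_cases hM : (M : ℂ) = 0
    · simp [hM]
    · simp [inv_mul_cancel₀ hM]
  rw [← ofReal_integral_norm_eq_lintegral_enorm
    (continuous_fejerKernel M).integrable_haarAddCircle]
  exact ENNReal.ofReal_le_one.2 h1

theorem coeFn_fejerMean (M : ℕ) (f : Lp E 1 (haarAddCircle (T := T))) :
    fejerMean T E M f =ᵐ[haarAddCircle] fun x =>
      ∫ t, fejerKernel M (x - t) • f t ∂haarAddCircle := by
  rw [fejerMean_apply]
  refine (Lp.coeFn_smul _ _).trans ?_
  filter_upwards [coeFn_sum_monomialLp (T := T) (Finset.range M ×ˢ Finset.range M)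
    (fun p => (p.1 : ℤ) - p.2) fun p => fourierCoeff f ((p.1 : ℤ) - p.2)] with x hx
  rw [Pi.smul_apply, hx, trigSum]
  have e : ∀ t, fejerKernel M (x - t) • f t = (M : ℂ)⁻¹ •
      ∑ p ∈ Finset.range M ×ˢ Finset.range M, fourier ((p.1 : ℤ) - p.2) x •
        (fourier (-((p.1 : ℤ) - p.2)) t • f t) := fun t => by
    rw [fejerKernel, mul_smul, Finset.sum_smul]
    congr 1
    refine Finset.sum_congr rfl fun p _ => ?_
    rw [smul_smul]
    congr 1
    simp only [fourier_apply, neg_smul, ← smul_neg]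
    rw [← Circle.coe_mul, ← AddCircle.toCircle_add, ← smul_add, ← sub_eq_add_neg x t]
  have hint : ∀ n : ℤ, Integrable (fun t => fourier n t • f t) haarAddCircle := fun n =>
    (L1.integrable_coeFn f).fourier_smul n
  simp_rw [e]
  rw [integral_smul, integral_finsetSum _ fun p _ => (hint (-((p.1 : ℤ) - p.2))).fun_smul
    (fourier ((p.1 : ℤ) - p.2) x)]
  simp_rw [integral_smul]
  rfl

theorem norm_fejerMean_le (M : ℕ) (f : Lp E 1 (haarAddCircle (T := T))) :
    ‖fejerMean T E M f‖ ≤ ‖f‖ := by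
  rw [← enorm_le_iff_norm_le, Lp.enorm_def, Lp.enorm_def, eLpNorm_one_eq_lintegral_enorm,
    eLpNorm_one_eq_lintegral_enorm]
  have hf := (L1.integrable_coeFn f).aestronglyMeasurable
  calc ∫⁻ x, ‖fejerMean T E M f x‖ₑ ∂haarAddCircle
      = ∫⁻ x, ‖∫ t, fejerKernel M (x - t) • f t ∂haarAddCircle‖ₑ ∂haarAddCircle :=
        lintegral_congr_ae ((coeFn_fejerMean M f).fun_comp _)
    _ ≤ ∫⁻ x, ∫⁻ t, ‖fejerKernel M (x - t)‖ₑ * ‖f t‖ₑ ∂haarAddCircle ∂haarAddCircle := by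
        refine lintegral_mono fun x => (enorm_integral_le_lintegral_enorm _).trans (le_of_eq ?_)
        simp_rw [enorm_smul]
    _ = ∫⁻ t, ∫⁻ x, ‖fejerKernel M (x - t)‖ₑ * ‖f t‖ₑ ∂haarAddCircle ∂haarAddCircle := by
        refine lintegral_lintegral_swap (AEMeasurable.mul ?_ hf.enorm.comp_snd)
        have : Continuous fun p : AddCircle T × AddCircle T => fejerKernel M (p.1 - p.2) :=
          (continuous_fejerKernel M).comp (by fun_prop)
        exact this.enorm.measurable.aemeasurable
    _ = ∫⁻ t, (∫⁻ x : AddCircle T, ‖fejerKernel M x‖ₑ ∂haarAddCircle) * ‖f t‖ₑ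
          ∂haarAddCircle := by
        refine lintegral_congr fun t => ?_
        rw [lintegral_mul_const' _ _ (by finiteness),
          lintegral_sub_right_eq_self (fun x => ‖fejerKernel M x‖ₑ)]
    _ ≤ ∫⁻ t, 1 * ‖f t‖ₑ ∂haarAddCircle := by
        gcongr
        exact lintegral_enorm_fejerKernel_le M
    _ = ∫⁻ t, ‖f t‖ₑ ∂haarAddCircle := by simp_rw [one_mul]

end Fejer

/-! ### Convergence of Fejér means in `L¹`. -/

section FejerConvergence

open Filter Topology

variable {T : ℝ} [hT : Fact (0 < T)] {E : Type*} [NormedAddCommGroup E] [NormedSpace ℂ E]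

theorem card_filter_sub_eq_le (M : ℕ) (n : ℤ) :
    ((Finset.range M ×ˢ Finset.range M).filter fun p : ℕ × ℕ => (p.1 : ℤ) - p.2 = n).card ≤ M := by
  conv_rhs => rw [← Finset.card_range M]
  refine Finset.card_le_card_of_injOn Prod.fst (fun p hp => ?_) fun p hp q hq h => ?_
  · simp only [Finset.coe_filter, Finset.mem_product, Set.mem_ofPred_eq] at hp
    exact hp.1.1
  · simp only [Finset.coe_filter, Finset.mem_product, Set.mem_ofPred_eq] at hp hq
    exact Prod.ext h (by have := hp.2; have := hq.2; omega)

theorem le_card_filter_sub_eq (M : ℕ) (n : ℤ) :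
    (M : ℤ) - |n| ≤
      ((Finset.range M ×ˢ Finset.range M).filter fun p : ℕ × ℕ => (p.1 : ℤ) - p.2 = n).card := by
  have h : (Finset.range (M - n.natAbs)).card ≤
      ((Finset.range M ×ˢ Finset.range M).filter fun p : ℕ × ℕ => (p.1 : ℤ) - p.2 = n).card := by
    -- The shifts are by the positive and the negative part of `n`, of which at least one is zero.
    refine Finset.card_le_card_of_injOn (fun i => (i + n.toNat, i + (-n).toNat)) (fun i hi => ?_)
      fun i _ j _ h => ?_
    · simp only [Finset.coe_range, Set.mem_Iio] at hi
      simp only [Finset.coe_filter, Finset.mem_product, Set.mem_ofPred_eq, Finset.mem_range]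
      omega
    · have := congrArg Prod.fst h
      simpa using this
  rw [Finset.card_range] at h
  rw [Int.abs_eq_natAbs]
  omega

theorem tendsto_card_filter_sub_eq_div (n : ℤ) :
    Tendsto (fun M : ℕ => (M : ℝ)⁻¹ * ((Finset.range M ×ˢ Finset.range M).filter
      fun p : ℕ × ℕ => (p.1 : ℤ) - p.2 = n).card) atTop (𝓝 1) := by
  have h1 : Tendsto (fun M : ℕ => 1 - |(n : ℝ)| * (M : ℝ)⁻¹) atTop (𝓝 (1 - |(n : ℝ)| * 0)) :=
    (tendsto_inv_atTop_nhds_zero_nat.const_mul _).const_sub _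
  rw [mul_zero, sub_zero] at h1
  refine tendsto_of_tendsto_of_tendsto_of_le_of_le' h1 tendsto_const_nhds ?_ ?_
  · filter_upwards [eventually_gt_atTop 0] with M hM
    have hM' : (0 : ℝ) < M := by exact_mod_cast hM
    have h2 : (M : ℝ) - |(n : ℝ)| ≤ ((Finset.range M ×ˢ Finset.range M).filter
        fun p : ℕ × ℕ => (p.1 : ℤ) - p.2 = n).card := by
      exact_mod_cast le_card_filter_sub_eq M n
    rw [le_inv_mul_iff₀ hM']
    field_simp
    linarith
  · filter_upwards [eventually_gt_atTop 0] with M hM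
    have hM' : (0 : ℝ) < M := by exact_mod_cast hM
    rw [inv_mul_le_iff₀ hM', mul_one]
    exact_mod_cast card_filter_sub_eq_le M n

variable (T E) in
/-- The functions that are the limits of their Fejér means. -/
noncomputable def fejerSubmodule : Submodule ℂ (Lp E 1 (haarAddCircle (T := T))) where
  carrier := {f | Tendsto (fun M => fejerMean T E M f) atTop (𝓝 f)}
  zero_mem' := by simp
  add_mem' {f g} hf hg := by simpa using hf.add hg
  smul_mem' z f hf := by simpa using hf.const_smul z

theorem mem_fejerSubmodule {f : Lp E 1 (haarAddCircle (T := T))} :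
    f ∈ fejerSubmodule T E ↔ Tendsto (fun M => fejerMean T E M f) atTop (𝓝 f) := Iff.rfl

/-- The Fejér means are uniformly contractive, so convergence passes to limits by an `ε / 3`
argument. -/
theorem isClosed_fejerSubmodule :
    IsClosed (fejerSubmodule T E : Set (Lp E 1 (haarAddCircle (T := T)))) := by
  refine isClosed_of_closure_subset fun f hf => ?_
  rw [SetLike.mem_coe, mem_fejerSubmodule, Metric.tendsto_atTop]
  intro ε hε
  obtain ⟨g, hg, hfg⟩ := Metric.mem_closure_iff.1 hf (ε / 3) (by positivity)
  rw [SetLike.mem_coe, mem_fejerSubmodule, Metric.tendsto_atTop] at hg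
  obtain ⟨N, hN⟩ := hg (ε / 3) (by positivity)
  refine ⟨N, fun M hM => ?_⟩
  have h1 := hN M hM
  have h2 := norm_fejerMean_le M (f - g)
  rw [map_sub] at h2
  rw [dist_eq_norm] at hfg h1 ⊢
  have e : fejerMean T E M f - f =
      (fejerMean T E M f - fejerMean T E M g) + (fejerMean T E M g - g) - (f - g) := by abel
  rw [e]
  have h3 := norm_sub_le ((fejerMean T E M f - fejerMean T E M g) + (fejerMean T E M g - g)) (f - g)
  have h4 := norm_add_le (fejerMean T E M f - fejerMean T E M g) (fejerMean T E M g - g)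
  linarith

variable [CompleteSpace E]

theorem monomialLp_mem_fejerSubmodule (n : ℤ) (v : E) :
    monomialLp T E n v ∈ fejerSubmodule T E := by
  rw [mem_fejerSubmodule]
  have hc : ∀ m, fourierCoeff (monomialLp T E n v) m = if n = m then v else 0 := fun m => by
    have := fourierCoeffCLM_sum_monomialLp (T := T) {()} (fun _ => n) (fun _ => v) m
    simpa [fourierCoeffCLM_apply] using this
  have e : ∀ M : ℕ, fejerMean T E M (monomialLp T E n v) = (((M : ℝ)⁻¹ *
      ((Finset.range M ×ˢ Finset.range M).filter fun p : ℕ × ℕ =>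
        (p.1 : ℤ) - p.2 = n).card : ℝ) : ℂ) •
        monomialLp T E n v := by
    intro M
    rw [fejerMean_apply]
    simp_rw [hc]
    have e1 : ∀ p : ℕ × ℕ, monomialLp T E ((p.1 : ℤ) - p.2)
        (if n = (p.1 : ℤ) - p.2 then v else 0) =
          if (p.1 : ℤ) - p.2 = n then monomialLp T E n v else 0 := fun p => by
      by_cases h : (p.1 : ℤ) - p.2 = n
      · simp [h]
      · rw [if_neg h, if_neg (Ne.symm h), map_zero]
    simp_rw [e1]
    rw [← Finset.sum_filter, Finset.sum_const, ← Nat.cast_smul_eq_nsmul ℂ, smul_smul]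
    push_cast
    rfl
  simp_rw [e]
  have h := ((Complex.continuous_ofReal.tendsto 1).comp
    (tendsto_card_filter_sub_eq_div n)).smul_const (monomialLp T E n v)
  rwa [Complex.ofReal_one, one_smul] at h

/-- The Fejér means of an integrable function converge to it in `L¹`. -/
theorem tendsto_fejerMean (f : Lp E 1 (haarAddCircle (T := T))) :
    Tendsto (fun M => fejerMean T E M f) atTop (𝓝 f) := by
  rw [← mem_fejerSubmodule]
  -- For a scalar function times a fixed vector, density of scalar trigonometric polynomials
  -- suffices. Indicator functions times vectors are of this kind, and they generate the
  -- vector-valued `L¹`.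
  have hscal : ∀ (v : E) (g : Lp ℂ 1 (haarAddCircle (T := T))),
      (ContinuousLinearMap.toSpanSingleton ℂ v).compLpL 1 haarAddCircle g ∈
        fejerSubmodule T E := by
    intro v g
    set Φ := (ContinuousLinearMap.toSpanSingleton ℂ v).compLpL 1 (haarAddCircle (T := T)) with hΦ
    have h1 : Submodule.span ℂ (Set.range (fourierLp (T := T) 1)) ≤
        (fejerSubmodule T E).comap Φ.toLinearMap := by
      rw [Submodule.span_le]
      rintro _ ⟨n, rfl⟩
      have e : Φ (fourierLp 1 n) = monomialLp T E n v := by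
        apply Lp.ext
        have h2 := coeFn_sum_monomialLp (T := T) {()} (fun _ => n) fun _ => v
        simp only [Finset.sum_singleton] at h2
        refine (ContinuousLinearMap.coeFn_compLpL _ _).trans (EventuallyEq.trans ?_ h2.symm)
        filter_upwards [coeFn_fourierLp (T := T) 1 n] with t ht
        rw [ht]
        simp [trigSum]
      change Φ (fourierLp 1 n) ∈ fejerSubmodule T E
      rw [e]
      exact monomialLp_mem_fejerSubmodule n v
    have h2 := Submodule.topologicalClosure_minimal _ h1
      (isClosed_fejerSubmodule.preimage Φ.continuous)
    rw [span_fourierLp_closure_eq_top ENNReal.one_ne_top] at h2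
    exact h2 trivial
  refine Lp.induction ENNReal.one_ne_top (fun f => f ∈ fejerSubmodule T E) ?_ ?_
    isClosed_fejerSubmodule f
  · intro v s hs hμs
    rw [Lp.simpleFunc.coe_indicatorConst]
    convert hscal v (indicatorConstLp 1 hs hμs.ne 1) using 1
    apply Lp.ext
    refine indicatorConstLp_coeFn.trans (EventuallyEq.symm ?_)
    refine (ContinuousLinearMap.coeFn_compLpL _ _).trans ?_
    filter_upwards [indicatorConstLp_coeFn (p := 1) (hs := hs) (hμs := hμs.ne) (c := (1 : ℂ))]
      with t ht
    rw [ht]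
    by_cases h : t ∈ s <;> simp [h]
  · intro f g hf hg _ hf' hg'
    exact (fejerSubmodule T E).add_mem hf' hg'

end FejerConvergence

/-! ### Passage from finite polynomials to arbitrary functions with lacunary spectrum. -/

section Approximation

variable {T : ℝ} [hT : Fact (0 < T)]

variable (T) in
/-- The trigonometric polynomial `∑ j, e^{i k(j) t} c j` as an element of `L¹`. -/
noncomputable def lacunaryPoly {E : Type*} [NormedAddCommGroup E] [NormedSpace ℂ E] (k : ℕ → ℕ) :
    (ℕ →₀ E) →ₗ[ℂ] Lp E 1 (haarAddCircle (T := T)) :=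
  Finsupp.lsum ℂ fun j => monomialLp T E (k j)

theorem lacunaryPoly_apply {E : Type*} [NormedAddCommGroup E] [NormedSpace ℂ E] (k : ℕ → ℕ)
    (c : ℕ →₀ E) : lacunaryPoly T k c = ∑ j ∈ c.support, monomialLp T E (k j) (c j) := rfl

theorem fourierCoeff_lacunaryPoly {E : Type*} [NormedAddCommGroup E] [NormedSpace ℂ E]
    [CompleteSpace E] {k : ℕ → ℕ} (hk : Function.Injective k) (c : ℕ →₀ E) (j : ℕ) :
    fourierCoeff (lacunaryPoly T k c) (k j) = c j := by
  rw [lacunaryPoly_apply, ← fourierCoeffCLM_apply, fourierCoeffCLM_sum_monomialLp c.support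
    (fun j => (k j : ℤ)) c]
  simp_rw [Nat.cast_inj, hk.eq_iff]
  simp

theorem exists_fejerMean_eq_lacunaryPoly {E : Type*} [NormedAddCommGroup E] [NormedSpace ℂ E]
    (k : ℕ → ℕ) (f : Lp E 1 (haarAddCircle (T := T)))
    (hf : ∀ n : ℤ, n ∉ Set.range (fun j => (k j : ℤ)) → fourierCoeff f n = 0) (M : ℕ) :
    ∃ c : ℕ →₀ E, fejerMean T E M f = lacunaryPoly T k c := by
  have h1 : ∀ p ∈ Finset.range M ×ˢ Finset.range M,
      monomialLp T E ((p.1 : ℤ) - p.2) (fourierCoeff f ((p.1 : ℤ) - p.2)) ∈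
        LinearMap.range (lacunaryPoly (E := E) T k) := by
    intro p _
    by_cases h : (p.1 : ℤ) - p.2 ∈ Set.range fun j => (k j : ℤ)
    · obtain ⟨j, hj⟩ := h
      refine ⟨Finsupp.single j (fourierCoeff f ((p.1 : ℤ) - p.2)), ?_⟩
      simp only [lacunaryPoly, Finsupp.lsum_single]
      rw [← hj]
    · rw [hf _ h, map_zero]
      exact zero_mem _
  have h2 : fejerMean T E M f ∈ LinearMap.range (lacunaryPoly (E := E) T k) := by
    rw [fejerMean_apply]
    exact Submodule.smul_mem _ _ (Submodule.sum_mem _ h1)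
  obtain ⟨c, hc⟩ := h2
  exact ⟨c, hc.symm⟩

variable {H : Type*} [NormedAddCommGroup H] [InnerProductSpace ℂ H] [CompleteSpace H]

variable (H) in
/-- The finitely supported sequences of operators that vanish on all but finitely many
basis vectors. -/
noncomputable def finiteBasisSubgroup : AddSubgroup (ℕ →₀ SchattenOne H) where
  carrier := {c | ∃ F : Finset (exists_hilbertBasis ℂ H).choose,
    ∀ j, ∀ i ∉ F, SchattenOne.toCLM H (c j) (onb H i) = 0}
  zero_mem' := ⟨∅, by simp⟩
  add_mem' := by
    classical
    rintro c d ⟨F, hF⟩ ⟨G, hG⟩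
    refine ⟨F ∪ G, fun j i hi => ?_⟩
    rw [Finset.mem_union, not_or] at hi
    simp [hF j i hi.1, hG j i hi.2]
  neg_mem' := by
    rintro c ⟨F, hF⟩
    exact ⟨F, fun j i hi => by simp [hF j i hi]⟩

theorem norm_monomialLp {E : Type*} [NormedAddCommGroup E] [NormedSpace ℂ E] (n : ℤ) (v : E) :
    ‖monomialLp T E n v‖ = ‖v‖ := by
  have h := norm_sum_monomialLp (T := T) {()} (fun _ => n) fun _ => v
  simpa [trigSum, norm_smul, fourier_apply, Circle.norm_coe] using h

theorem lacunaryPoly_mem_closure (k : ℕ → ℕ) (c : ℕ →₀ SchattenOne H) :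
    lacunaryPoly T k c ∈ closure (lacunaryPoly T k '' (finiteBasisSubgroup H)) := by
  classical
  rw [Metric.mem_closure_iff]
  intro ε hε
  have hδ : 0 < ε / 2 / (c.support.card + 1) := by positivity
  choose F₀ hF₀ using fun j => (c j).exists_norm_sub_truncateBasis_le hδ
  set F := c.support.biUnion F₀ with hF
  let b : ℕ →₀ SchattenOne H := c.mapRange (fun A => A.truncateBasis F)
    (by simp [SchattenOne.truncateBasis, SchattenOne.rankOne_zero_left])
  refine ⟨_, ⟨b, ⟨F, fun j i hi => ?_⟩, rfl⟩, ?_⟩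
  · rw [Finsupp.mapRange_apply, SchattenOne.toCLM_truncateBasis_apply, if_neg hi]
  · have e : lacunaryPoly T k b = ∑ j ∈ c.support, monomialLp T _ (k j) (b j) :=
      Finsupp.sum_of_support_subset _ Finsupp.support_mapRange _ fun _ _ => map_zero _
    rw [dist_eq_norm, e, lacunaryPoly_apply, ← Finset.sum_sub_distrib]
    have h1 : ∀ j ∈ c.support, ‖monomialLp T _ (k j) (c j) - monomialLp T _ (k j) (b j)‖ ≤
        ε / 2 / (c.support.card + 1) := fun j hj => by
      rw [← map_sub, norm_monomialLp]
      exact hF₀ j F (Finset.subset_biUnion_of_mem F₀ hj)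
    refine (norm_sum_le_of_le _ h1).trans_lt ?_
    rw [Finset.sum_const, nsmul_eq_mul, mul_div_assoc', div_lt_iff₀ (by positivity)]
    nlinarith [Nat.cast_nonneg (α := ℝ) c.support.card]

theorem mem_closure_lacunaryPoly (k : ℕ → ℕ)
    (f : Lp (SchattenOne H) 1 (haarAddCircle (T := T)))
    (hf : ∀ n : ℤ, n ∉ Set.range (fun j => (k j : ℤ)) → fourierCoeff f n = 0) :
    f ∈ closure (lacunaryPoly T k '' (finiteBasisSubgroup H)) := by
  rw [← closure_closure]
  refine mem_closure_of_tendsto (tendsto_fejerMean f) (.of_forall fun M => ?_)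
  obtain ⟨c, hc⟩ := exists_fejerMean_eq_lacunaryPoly k f hf M
  rw [hc]
  exact lacunaryPoly_mem_closure k c

/-- The inequality for functions with a strongly lacunary spectrum. -/
theorem splittingNorm_fourierCoeff_le {k : ℕ → ℕ} (hk : IsStronglyLacunary k)
    (f : Lp (SchattenOne H) 1 (haarAddCircle (T := T)))
    (hf : ∀ n : ℤ, n ∉ Set.range (fun j => (k j : ℤ)) → fourierCoeff f n = 0) :
    splittingNorm (fun j => SchattenOne.toCLM H (fourierCoeff f (k j))) ≤
      ENNReal.ofReal (2 * ‖f‖) := by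
  refine ENNReal.le_of_forall_pos_le_add fun ε hε _ => ?_
  have hmem : f ∈ closure (((finiteBasisSubgroup H).map
      (lacunaryPoly (E := SchattenOne H) T k).toAddMonoidHom :
        AddSubgroup (Lp (SchattenOne H) 1 (haarAddCircle (T := T)))) : Set _) :=
    mem_closure_lacunaryPoly k f hf
  have hb : ∀ n : ℕ, 0 < (ε : ℝ) / 4 * (1 / 2) ^ n := fun n => by positivity
  -- `f` is written as a series of admissible polynomials, the first close to `f` and the rest
  -- geometrically small, so that countable subadditivity replaces any continuity of the infimum.
  -- The norms sum to at most `‖f‖ + ε / 2`; the factor 2 of the inequality turns this into `2 ‖f‖ +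
  -- ε`.
  obtain ⟨v, hv, hvmem, hv0, hvn⟩ := controlled_sum_of_mem_closure hmem hb
  choose c hc hcv using hvmem
  have hcv' : ∀ n, lacunaryPoly T k (c n) = v n := hcv
  have hgeo : HasSum (fun n : ℕ => (ε : ℝ) / 4 * (1 / 2) ^ n) (ε / 2) := by
    rw [show (ε : ℝ) / 2 = ε / 4 * 2 by ring]
    exact hasSum_geometric_two.mul_left _
  set B : ℕ → ℝ := fun n => (if n = 0 then ‖f‖ else 0) + (ε : ℝ) / 4 * (1 / 2) ^ n with hB
  have hvB : ∀ n, ‖v n‖ ≤ B n := by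
    intro n
    rcases Nat.eq_zero_or_pos n with rfl | hn
    · have h1 : ‖v 0‖ ≤ ‖f‖ + ‖-v 0 + f‖ := by
        have := norm_sub_le f (-v 0 + f)
        rwa [show f - (-v 0 + f) = v 0 by abel] at this
      simp only [hB, if_true]
      linarith
    · simp only [hB, if_neg hn.ne', zero_add]
      exact (hvn n hn).le
  have hBsum : HasSum B (‖f‖ + ε / 2) := (hasSum_ite_eq 0 ‖f‖).add hgeo
  have hvsum : Summable v := .of_norm_bounded hBsum.summable hvB
  have hvf : HasSum v f := by
    -- The partial sums in `hv` run up to and including `n`, hence the shift by one.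
    rw [hvsum.hasSum_iff_tendsto_nat, ← Filter.tendsto_add_atTop_iff_nat 1]
    exact hv
  have hsum : ∀ j, HasSum (fun n => operatorSeq (c n) j)
      (SchattenOne.toCLM H (fourierCoeff f (k j))) := by
    intro j
    have h1 := (hvf.mapL (fourierCoeffCLM T (SchattenOne H) (k j))).mapL
      SchattenOne.toCLMContinuous
    have e : ∀ n, SchattenOne.toCLMContinuous (fourierCoeffCLM T (SchattenOne H) (k j) (v n)) =
        operatorSeq (c n) j := fun n => by
      rw [← hcv', fourierCoeffCLM_apply, fourierCoeff_lacunaryPoly hk.injective]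
      rfl
    simp_rw [e] at h1
    exact h1
  refine (splittingNorm_hasSum_le hsum).trans ?_
  have hle : ∀ n, splittingNorm (operatorSeq (c n)) ≤ ENNReal.ofReal (2 * B n) := by
    intro n
    obtain ⟨F, hF⟩ := hc n
    refine (splittingNorm_operatorSeq_le (T := T) hk (c n) F hF).trans
      (ENNReal.ofReal_le_ofReal ?_)
    rw [← norm_sum_monomialLp, ← lacunaryPoly_apply, hcv']
    linarith [hvB n]
  refine (ENNReal.tsum_le_tsum hle).trans ?_
  have hB0 : ∀ n, 0 ≤ 2 * B n := fun n => by linarith [(norm_nonneg _).trans (hvB n)]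
  rw [← ENNReal.ofReal_tsum_of_nonneg hB0 (hBsum.mul_left 2).summable, (hBsum.mul_left 2).tsum_eq,
    ← ENNReal.ofReal_coe_nnreal, ← ENNReal.ofReal_add (by positivity) (by positivity)]
  exact ENNReal.ofReal_le_ofReal (by linarith)

end Approximation

theorem corollary3 :
    ∃ C : ℝ, 0 < C ∧
      ∀ (H : Type*) [NormedAddCommGroup H] [InnerProductSpace ℂ H] [CompleteSpace H]
        (k : ℕ → ℕ), IsStronglyLacunary k →
      ∀ f : MeasureTheory.Lp (SchattenOne H) 1 (AddCircle.haarAddCircle (T := 2 * Real.pi)),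
        (∀ n : ℤ, n ∉ Set.range (fun j => (k j : ℤ)) → fourierCoeff f n = 0) →
        splittingNorm (fun j => SchattenOne.toCLM H (fourierCoeff f (k j))) ≤
          ENNReal.ofReal (C * ‖f‖) :=
  ⟨2, two_pos, fun _ _ _ _ _ hk f hf => splittingNorm_fourierCoeff_le hk f hf⟩
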